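/- Fix constants $\beta>0$, $0<c_1<1$ and $0<c_{\mathrm{lo}},c_{\mathrm{hi}}<\infty$. **Setting.** Let $T\ge 1$ be the horizon, $0\le V_T\le T$ and $S_T\in\{1,\dots,T\}$. There are infinitely many arms $a\in\mathcal A$ with i.i.d. initial mean rewards $\mu_1(a)\in[0,1]$ such that $$c_{\mathrm{lo}}\,x^\beta\le \mathbb P(\mu_1(a)>1-x)\le c_{\mathrm{hi}}\,x^\beta\qquad\text{for all }x\in[0,1].$$ In round $t=1,2,\dots,T$ an arm $a_t$ is pulled and the reward $r_t=\mu_t(a_t)+\eta_t$ is observed, where $\eta_t$ is $1$-sub-Gaussian conditionally on the initial means and on everything that happened before round $t$. An adaptive adversary then chooses $\rho_t\ge 0$ on the basis of everything that has happened so far (the initial means included), and the means are updated by $\mu_{t+1}(a_t)=\mu_t(a_t)-\rho_t$ and $\mu_{t+1}(a)=\mu_t(a)$ for $a\ne a_t$. The adversary satisfies both $$\sum_{t=1}^{T-1}\rho_t\le V_T\qquad\text{and}\qquad 1+\sum_{t=1}^{T-1}\mathbf 1(\rho_t\ne 0)\le S_T .$$ **Algorithm with threshold parameter $\delta$.** New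 arms are taken one after the other from a sequence of distinct arms fixed in advance. The first arm is selected and pulled in round $1$. In round $t=2,\dots,T$ let $a$ be the arm pulled in round $t-1$ and $t(a)$ the round in which it was selected. If $$\min_{s}\ \bigl(\widehat\mu_{[s,t-1]}(a)+\sqrt{12\log(T)/n_{[s,t-1]}(a)}\bigr)<1-\delta ,$$ where $s$ runs over the integers of the form $s=t-2^{i}$, $i\in\{0,1,2,\dots\}$, with $t(a)\le s\le t-1$, then $a$ is withdrawn for good and a new arm is selected and pulled; otherwise $a$ is pulled again. Here $n_{[s,t-1]}(a)$ is the number of pulls of $a$ in the rounds $s,\dots,t-1$ and $\widehat\mu_{[s,t-1]}(a)$ is the average of the rewards of these pulls. **Parameters and rates.** Put $$\delta_V=\begin{cases}c_1\max\{(V_T/T)^{\frac1{\beta+2}},T^{-\frac1{\beta+1}}\}&\beta\ge1\\ c_1\max\{(V_T/T)^{\frac13},T^{-\frac12}\}&0<\beta<1\end{cases}\qquad \delta_S=\begin{cases}c_1(S_T/T)^{\frac1{\beta+1}}&\beta\ge 1\\ c_1(S_T/T)^{\frac12}&0<\beta<1\end{cases}$$ $$R_V=\begin{cases}\max\{V_T^{\frac1{\beta+2}}T^{\frac{\beta+1}{\beta+2}},T^{\frac{\beta}{\beta+1}}\}&\beta\ge1\\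 \max\{V_T^{\frac13}T^{\frac23},\sqrt T\}&0<\beta<1\end{cases}\qquad R_S=\begin{cases}\max\{S_T^{\frac1{\beta+1}}T^{\frac\beta{\beta+1}},V_T\}&\beta\ge1\\ \max\{\sqrt{S_TT},V_T\}&0<\beta<1.\end{cases}$$ **Claim.** The algorithm with $\delta=\min\{\delta_V,\delta_S\}$ has expected regret $$\mathbb E\Bigl[\sum_{t=1}^T(1-\mu_t(a_t))\Bigr]=\tilde O(\min\{R_V,R_S\}).$$ That is, there are $C>0$ and $k\in\mathbb N$, depending only on $\beta,c_1,c_{\mathrm{lo}},c_{\mathrm{hi}}$, such that for all $T,V_T,S_T$ and all environments as above the regret is integrable and its expectation is at most $C(1+\log T)^k\min\{R_V,R_S\}$. -/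

import Mathlib

open MeasureTheory ProbabilityTheory Finset

namespace RottingBandit

noncomputable section

open scoped Classical

universe u v

variable {𝒜 : Type u} {Ω : Type v}

/-! ### The window-UCB index -/

/-- `n_{[t₁,t₂]}(b)`: the number of pulls of arm `b` during the rounds `t₁, …, t₂`. -/
def pullCount (arm : ℕ → 𝒜) (b : 𝒜) (t₁ t₂ : ℕ) : ℕ :=
  ((Icc t₁ t₂).filter fun t => arm t = b).card

/-- `μ̂_{[t₁,t₂]}(b)`: the average reward collected from arm `b` during the rounds `t₁, …, t₂`. -/
def empMean (arm : ℕ → 𝒜) (rew : ℕ → ℝ) (b : 𝒜) (t₁ t₂ : ℕ) : ℝ :=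
  (∑ t ∈ Icc t₁ t₂, if arm t = b then rew t else 0) / (pullCount arm b t₁ t₂ : ℝ)

/-- `WUCB(b, t₁, t₂, T)`. -/
def wucb (T : ℕ) (arm : ℕ → 𝒜) (rew : ℕ → ℝ) (b : 𝒜) (t₁ t₂ : ℕ) : ℝ :=
  empMean arm rew b t₁ t₂ + √(12 * Real.log T / (pullCount arm b t₁ t₂ : ℝ))

/-- `𝒯_t(a)`, where `t₀ = t(a)` is the round in which the current arm was selected: the starting
rounds `s` of the windows `[s, t - 1]` whose lengths are powers of two. -/
def windowStarts (T t₀ t : ℕ) : Finset ℕ :=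
  (Icc 1 T).filter fun s => t₀ ≤ s ∧ s < t ∧ ∃ i : ℕ, s + 2 ^ i = t

/-! ### The interaction of the algorithm with the environment -/

/-- The situation between two rounds. -/
structure Config (𝒜 : Type u) where
  /-- position, in the order of selection, of the arm that is currently in use -/
  idx : ℕ
  /-- the round in which that arm was selected -/
  start : ℕ
  /-- the arms pulled in the past rounds (later entries carry no information) -/
  arm : ℕ → 𝒜
  /-- the rewards obtained in the past rounds (later entries carry no information) -/
  rew : ℕ → ℝ
  /-- the present mean rewards of all arms (not visible to the algorithm) -/
  mean : 𝒜 → ℝ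

/-- The threshold condition tested at the beginning of round `t`:
`min_{s ∈ 𝒯_t(a)} WUCB(a, s, t - 1, T) < 1 - δ` for the current arm `a`, written as the existence
of a window whose index is below the threshold. -/
def Withdraw (T : ℕ) (δ : ℝ) (sel : ℕ → 𝒜) (t : ℕ) (c : Config 𝒜) : Prop :=
  ∃ s ∈ windowStarts T c.start t, wucb T c.arm c.rew (sel c.idx) s (t - 1) < 1 - δ

/-- Position of the arm that the algorithm pulls in round `t`. -/
def nextIdx (T : ℕ) (δ : ℝ) (sel : ℕ → 𝒜) (t : ℕ) (c : Config 𝒜) : ℕ :=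
  if Withdraw T δ sel t c then c.idx + 1 else c.idx

/-- Round `t`: the algorithm keeps or replaces its arm, pulls it, and obtains the mean reward plus
the noise `η t`; then the mean reward of the pulled arm, and of no other arm, drops by `ρ t`. -/
def playRound (T : ℕ) (δ : ℝ) (sel : ℕ → 𝒜) (η ρ : ℕ → ℝ) (t : ℕ) (c : Config 𝒜) : Config 𝒜 where
  idx := nextIdx T δ sel t c
  start := if Withdraw T δ sel t c then t else c.start
  arm := Function.update c.arm t (sel (nextIdx T δ sel t c))
  rew := Function.update c.rew t (c.mean (sel (nextIdx T δ sel t c)) + η t)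
  mean := Function.update c.mean (sel (nextIdx T δ sel t c))
    (c.mean (sel (nextIdx T δ sel t c)) - ρ t)

/-- The situation after `t` rounds. New arms are taken in the order `sel 0, sel 1, …`; `m` gives
the initial mean rewards, `η t` and `ρ t` are the noise and the rotting rate of round `t ≥ 1`.
In round `1` there is no window to test, so that the arm `sel 0` is pulled. -/
def run (T : ℕ) (δ : ℝ) (sel : ℕ → 𝒜) (m : 𝒜 → ℝ) (η ρ : ℕ → ℝ) : ℕ → Config 𝒜
  | 0 => { idx := 0, start := 1, arm := fun _ => sel 0, rew := fun _ => 0, mean := m }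
  | t + 1 => playRound T δ sel η ρ (t + 1) (run T δ sel m η ρ t)

/-- The arm `a_t` pulled in round `t`. -/
def armAt (T : ℕ) (δ : ℝ) (sel : ℕ → 𝒜) (m : 𝒜 → ℝ) (η ρ : ℕ → ℝ) (t : ℕ) : 𝒜 :=
  (run T δ sel m η ρ t).arm t

/-- The mean reward `μ_t(b)` of arm `b` at the beginning of round `t ≥ 1`. -/
def meanAt (T : ℕ) (δ : ℝ) (sel : ℕ → 𝒜) (m : 𝒜 → ℝ) (η ρ : ℕ → ℝ) (t : ℕ) (b : 𝒜) : ℝ :=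
  (run T δ sel m η ρ (t - 1)).mean b

/-- The regret `R(T) = ∑_{t=1}^T (1 - μ_t(a_t))` of the algorithm with threshold parameter `δ`. -/
def regret (T : ℕ) (δ : ℝ) (sel : ℕ → 𝒜) (m : 𝒜 → ℝ) (η ρ : ℕ → ℝ) : ℝ :=
  ∑ t ∈ Icc 1 T, (1 - meanAt T δ sel m η ρ t (armAt T δ sel m η ρ t))

/-! ### The random environment -/

/-- The initial mean rewards are i.i.d. in `[0,1]`, and `ℙ(μ₁(a) > 1 - x) = Θ(x^β)` on `[0,1]`
with the constants `lo` and `hi`. -/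
structure InitialMeans [MeasurableSpace Ω] (P : Measure Ω) (β lo hi : ℝ) (μ₁ : 𝒜 → Ω → ℝ) :
    Prop where
  measurable : ∀ a, Measurable (μ₁ a)
  indep : iIndepFun μ₁ P
  identDistrib : ∀ a b, IdentDistrib (μ₁ a) (μ₁ b) P P
  mem_Icc : ∀ a, ∀ᵐ ω ∂P, μ₁ a ω ∈ Set.Icc (0 : ℝ) 1
  lower : ∀ a, ∀ x ∈ Set.Icc (0 : ℝ) 1, lo * x ^ β ≤ P.real {ω | 1 - x < μ₁ a ω}
  upper : ∀ a, ∀ x ∈ Set.Icc (0 : ℝ) 1, P.real {ω | 1 - x < μ₁ a ω} ≤ hi * x ^ β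

/-- The noise of each round is `1`-sub-Gaussian given everything that happened before it. -/
structure SubGaussianNoise [mΩ : MeasurableSpace Ω] (P : Measure Ω) (ℱ : Filtration ℕ mΩ)
    (η : ℕ → Ω → ℝ) : Prop where
  adapted : ∀ t, Measurable[ℱ t] (η t)
  integrable_exp : ∀ (t : ℕ) (z : ℝ), Integrable (fun ω => Real.exp (z * η (t + 1) ω)) P
  condExp_exp_le : ∀ (t : ℕ) (z : ℝ),
    P[fun ω => Real.exp (z * η (t + 1) ω) | ℱ t] ≤ᵐ[P] fun _ => Real.exp (z ^ 2 / 2)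

/-- An adaptive adversary that satisfies both the slow and the abrupt rotting constraint: the rate
`ρ t ≥ 0` is chosen after the pull of round `t` from the information available by then. -/
structure AdaptiveAdversary [mΩ : MeasurableSpace Ω] (P : Measure Ω) (ℱ : Filtration ℕ mΩ)
    (T : ℕ) (V : ℝ) (S : ℕ) (ρ : ℕ → Ω → ℝ) : Prop where
  adapted : ∀ t, Measurable[ℱ t] (ρ t)
  nonneg : ∀ t, ∀ᵐ ω ∂P, 0 ≤ ρ t ω
  slow : ∀ᵐ ω ∂P, ∑ t ∈ Ico 1 T, ρ t ω ≤ V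
  abrupt : ∀ᵐ ω ∂P, 1 + ((Ico 1 T).filter fun t => ρ t ω ≠ 0).card ≤ S

/-! ### Tuning parameters and rates -/

/-- `δ_V(β)`. -/
def deltaV (c₁ β V : ℝ) (T : ℕ) : ℝ :=
  if 1 ≤ β then c₁ * max ((V / T) ^ (1 / (β + 2))) (1 / (T : ℝ) ^ (1 / (β + 1)))
  else c₁ * max ((V / T) ^ (1 / 3 : ℝ)) (1 / √(T : ℝ))

/-- `δ_S(β)`. -/
def deltaS (c₁ β : ℝ) (S T : ℕ) : ℝ :=
  if 1 ≤ β then c₁ * ((S : ℝ) / T) ^ (1 / (β + 1)) else c₁ * ((S : ℝ) / T) ^ (1 / 2 : ℝ)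

/-- `R_V`. -/
def rateV (β V : ℝ) (T : ℕ) : ℝ :=
  if 1 ≤ β then
    max (V ^ (1 / (β + 2)) * (T : ℝ) ^ ((β + 1) / (β + 2))) ((T : ℝ) ^ (β / (β + 1)))
  else max (V ^ (1 / 3 : ℝ) * (T : ℝ) ^ (2 / 3 : ℝ)) √(T : ℝ)

/-- `R_S`. -/
def rateS (β V : ℝ) (S T : ℕ) : ℝ :=
  if 1 ≤ β then max ((S : ℝ) ^ (1 / (β + 1)) * (T : ℝ) ^ (β / (β + 1))) V
  else max √((S : ℝ) * T) V

end

end RottingBandit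

/-! Let `Δ` be the initial gap of an arm and `γ = max β 1`. As long as the noise stays within its
confidence width on every window, the run obeys deterministic inequalities (`thresholdPath_run`). A
passed test bounds the average gap over a dyadic window by `δ + O(√(log T / length))`, so an arm
used for `n` rounds costs at most `2δn + O(1 + log T) / max Δ δ` plus the rotting spent on it. An
arm is replaced only once its gap exceeds `δ`, so a good arm (`Δ < δ/2`) is replaced only after
rotting by more than `δ/2`. Hence fewer than `M` good arms are replaced, where either `M > 2V/δ` or
`M = S` will do.

The regret is therefore at most `2δT + V` plus `O(1 + log T)` times the sum of `1 / max Δ δ` over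
arms sampled until `M` good ones have appeared. This stopping rule reads the initial means only, so
the adaptivity of the adversary no longer matters, and the Wald-type bound
`integral_sum_until_hits_le` gives expectation at most `M · E[1 / max Δ δ] / P(Δ < δ/2)`. The
numerator is `δ ^ (β - γ)` up to a logarithm and the denominator is at least of order `δ ^ β`, which
leaves `Õ(M δ ^ (-γ))`. Noise outside its widths has probability at most `2 / T ^ 4`, while the
regret never exceeds `2 T ^ 2`.

It remains to balance `δT + M δ ^ (-γ) + V`. The choice `δ_V` does so for `M` about `2V/δ`, and
`δ_S` for `M = S`. Since `R_V = T * scaleV`, `R_S = max (T * scaleS) V` and `V ≤ T * scaleV`, the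
smaller threshold always belongs to the smaller rate. -/

namespace RottingBandit

noncomputable section

open scoped Classical

universe u v

variable {𝒜 : Type u} {Ω : Type v}

/-! ### Sums over dyadic windows -/

/-- If the sum of `g` over every window of dyadic length inside a block is controlled, then so is
the sum over the block. -/
theorem sum_Ico_le_of_dyadic_windows {g : ℕ → ℝ} {δ κ : ℝ} (hκ : 0 ≤ κ) (n : ℕ) : ∀ a : ℕ,
    (∀ s i, a ≤ s → s + 2 ^ i ≤ a + n →
      ∑ u ∈ Ico s (s + 2 ^ i), g u ≤ δ * 2 ^ i + κ * √(2 ^ i)) →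
    ∑ u ∈ Ico a (a + n), g u ≤ δ * n + 4 * κ * √n := by
  induction n using Nat.strong_induction_on with
  | _ n ih =>
    intro a h
    rcases Nat.eq_zero_or_pos n with rfl | hn
    · simp
    set i := Nat.log 2 n
    have h1 : 2 ^ i ≤ n := Nat.pow_log_le_self 2 hn.ne'
    have h2 : n < 2 ^ (i + 1) := Nat.lt_pow_succ_log_self (by norm_num) n
    have hpos : 0 < 2 ^ i := by positivity
    obtain ⟨r, hr⟩ := Nat.exists_eq_add_of_le h1
    have hrx : r ≤ 2 ^ i := by rw [pow_succ] at h2; omega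
    have hw := h a i le_rfl (by omega)
    have hrest := ih r (by omega) (a + 2 ^ i) (fun s j hs hj => h s j (by omega) (by omega))
    rw [← Finset.sum_Ico_consecutive g (Nat.le_add_right a (2 ^ i)) (by omega : a + 2 ^ i ≤ a + n)]
    have e : a + n = a + 2 ^ i + r := by omega
    rw [e]
    have hnr : (n : ℝ) = 2 ^ i + r := by rw [hr]; push_cast; ring
    have hrx' : (r : ℝ) ≤ 2 ^ i := by exact_mod_cast hrx
    -- The largest dyadic window is cut off, and the remainder is no longer than it. The recursion
    -- closes because `x + 4y ≤ 4√(x² + y²)` whenever `0 ≤ y ≤ x`.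
    have key : √((2 : ℝ) ^ i) + 4 * √(r : ℝ) ≤ 4 * √(n : ℝ) := by
      have ha : √((2 : ℝ) ^ i) ^ 2 = 2 ^ i := Real.sq_sqrt (by positivity)
      have hb : √(r : ℝ) ^ 2 = r := Real.sq_sqrt (by positivity)
      have hab : √(r : ℝ) ≤ √((2 : ℝ) ^ i) := Real.sqrt_le_sqrt hrx'
      have hc : √(n : ℝ) ^ 2 = 2 ^ i + r := by rw [Real.sq_sqrt (by positivity), hnr]
      refine abs_le_of_sq_le_sq' ?_ (by positivity) |>.2
      nlinarith [Real.sqrt_nonneg (r : ℝ), Real.sqrt_nonneg ((2 : ℝ) ^ i)]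
    have := mul_le_mul_of_nonneg_left key hκ
    rw [hnr] at this ⊢
    linarith

/-- If `Δ ≤ 2δ`, the term `4κ√n` is split by the arithmetic-geometric mean inequality. If `Δ > 2δ`,
then `Δn ≤ δn + 4κ√n` forces `√n ≤ 8κ/Δ`: a bad arm cannot last long. -/
theorem sum_Ico_le_of_dyadic_windows_of_le {g : ℕ → ℝ} {δ κ Δ : ℝ} (hκ : 0 ≤ κ) (hδ : 0 < δ)
    (a n : ℕ)
    (h : ∀ s i, a ≤ s → s + 2 ^ i ≤ a + n →
      ∑ u ∈ Ico s (s + 2 ^ i), g u ≤ δ * 2 ^ i + κ * √(2 ^ i))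
    (hΔ : ∀ u ∈ Ico a (a + n), Δ ≤ g u) :
    ∑ u ∈ Ico a (a + n), g u ≤ 2 * δ * n + 32 * κ ^ 2 / max Δ δ := by
  have hsum := sum_Ico_le_of_dyadic_windows hκ n a h
  have hx : √(n : ℝ) ^ 2 = n := Real.sq_sqrt (by positivity)
  have hx0 := Real.sqrt_nonneg (n : ℝ)
  set x := √(n : ℝ)
  have hm : 0 < max Δ δ := lt_max_of_lt_right hδ
  rcases le_or_gt Δ (2 * δ) with hle | hgt
  · have h1 : 4 * κ * x ≤ δ * n + 4 * κ ^ 2 / δ := by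
      rw [← hx, ← sub_nonneg]
      have : δ * x ^ 2 + 4 * κ ^ 2 / δ - 4 * κ * x = (δ * x - 2 * κ) ^ 2 / δ := by
        field_simp; ring
      rw [this]; positivity
    have h2 : 4 * κ ^ 2 / δ ≤ 32 * κ ^ 2 / max Δ δ := by
      have : max Δ δ ≤ 2 * δ := max_le hle (by linarith)
      rw [div_le_div_iff₀ hδ hm]
      nlinarith [mul_le_mul_of_nonneg_left this (sq_nonneg κ), mul_nonneg (sq_nonneg κ) hδ.le]
    linarith
  · have hΔ0 : 0 < Δ := by linarith
    have hlow : Δ * n ≤ ∑ u ∈ Ico a (a + n), g u := by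
      have := Finset.card_nsmul_le_sum _ _ _ hΔ
      simpa [mul_comm] using this
    have hxle : Δ * x ≤ 8 * κ := by
      rcases hx0.eq_or_lt with h0 | h0
      · rw [← h0]; simpa using by linarith
      · have : Δ * x * x ≤ 8 * κ * x := by nlinarith
        exact le_of_mul_le_mul_right this h0
    rw [max_eq_left (by linarith)]
    have : 4 * κ * x ≤ 32 * κ ^ 2 / Δ := by
      rw [le_div_iff₀ hΔ0]; nlinarith
    have : 0 ≤ δ * (n : ℝ) := by positivity
    linarith

/-! ### Gap sequences of a threshold policy -/

/-- An abstract threshold policy: `I t` is the position of the arm in use in round `t`, `g t` its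
gap, `Δ k` the initial gap of the arm at position `k`, and `ρ t` the rotting rate. Windows of
dyadic length that pass the test have a small average gap, and an arm is only replaced
when its gap exceeds `δ`. -/
structure ThresholdPath (T : ℕ) (δ κ : ℝ) (I : ℕ → ℕ) (g Δ ρ : ℕ → ℝ) : Prop where
  one : I 1 = 0
  step : ∀ t, 1 ≤ t → I (t + 1) = I t ∨ I (t + 1) = I t + 1
  gap : ∀ t, 1 ≤ t → g t = Δ (I t) + ∑ u ∈ (Ico 1 t).filter (fun u => I u = I t), ρ u
  keep : ∀ s i, 1 ≤ s → s + 2 ^ i ≤ T → I s = I (s + 2 ^ i) →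
    ∑ u ∈ Ico s (s + 2 ^ i), g u ≤ δ * 2 ^ i + κ * √(2 ^ i)
  drop : ∀ t, 1 ≤ t → t < T → I (t + 1) = I t + 1 → δ < g t

namespace ThresholdPath

variable {T : ℕ} {δ κ : ℝ} {I : ℕ → ℕ} {g Δ ρ : ℕ → ℝ}

theorem mono (h : ThresholdPath T δ κ I g Δ ρ) {s t : ℕ} (hs : 1 ≤ s) (hst : s ≤ t) :
    I s ≤ I t := by
  induction t, hst using Nat.le_induction with
  | base => exact le_rfl
  | succ t ht ih => rcases h.step t (by omega) with e | e <;> omega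

theorem lt (h : ThresholdPath T δ κ I g Δ ρ) {t : ℕ} (ht : 1 ≤ t) : I t < t := by
  induction t, ht using Nat.le_induction with
  | base => rw [h.one]; norm_num
  | succ t ht ih => rcases h.step t (by omega) with e | e <;> omega

theorem exists_drop (h : ThresholdPath T δ κ I g Δ ρ) {k t : ℕ} (ht : 1 ≤ t) (hk : k < I t) :
    ∃ s, 1 ≤ s ∧ s < t ∧ I s = k ∧ I (s + 1) = I s + 1 := by
  induction t, ht using Nat.le_induction with
  | base => rw [h.one] at hk; omega
  | succ t ht ih =>
    by_cases hk' : k < I t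
    · obtain ⟨s, h1, h2, h3⟩ := ih hk'
      exact ⟨s, h1, by omega, h3⟩
    · rcases h.step t ht with e | e
      · omega
      · exact ⟨t, ht, by omega, by omega, e⟩

theorem initialGap_le (h : ThresholdPath T δ κ I g Δ ρ) (hρ : ∀ t, 0 ≤ ρ t) {t : ℕ}
    (ht : 1 ≤ t) : Δ (I t) ≤ g t := by
  rw [h.gap t ht]
  exact le_add_of_nonneg_right (Finset.sum_nonneg fun u _ => hρ u)

theorem gap_le (h : ThresholdPath T δ κ I g Δ ρ) (hρ : ∀ t, 0 ≤ ρ t) {t : ℕ}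
    (ht : 1 ≤ t) (htT : t ≤ T) :
    g t ≤ Δ (I t) + ∑ u ∈ (Ico 1 T).filter (fun u => I u = I t), ρ u := by
  rw [h.gap t ht]
  refine add_le_add_right (Finset.sum_le_sum_of_subset_of_nonneg ?_ fun u _ _ => hρ u) _
  exact Finset.filter_subset_filter _ (Finset.Ico_subset_Ico le_rfl htT)

/-- By monotonicity of `I`, an arm is used on an interval of rounds. No passed test is available for
a window that includes its last round, so that round is bounded separately by the initial gap plus
the arm's total rotting; the `+ 1` next to `32 * κ ^ 2` pays for the initial gap, as `1 ≤ 1 / max (Δ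
k) δ`. -/
theorem sum_gap_of_arm_le (h : ThresholdPath T δ κ I g Δ ρ) (hρ : ∀ t, 0 ≤ ρ t) (hκ : 0 ≤ κ)
    (hδ : 0 < δ) (hδ1 : δ ≤ 1) (hΔ : ∀ k, Δ k ≤ 1) (k : ℕ) :
    ∑ u ∈ (Icc 1 T).filter (fun u => I u = k), g u ≤
      2 * δ * ((Icc 1 T).filter (fun u => I u = k)).card + (32 * κ ^ 2 + 1) * (1 / max (Δ k) δ) +
        ∑ u ∈ (Ico 1 T).filter (fun u => I u = k), ρ u := by
  set U := (Icc 1 T).filter (fun u => I u = k) with hU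
  have hm : 0 < max (Δ k) δ := lt_max_of_lt_right hδ
  have hv : 0 ≤ ∑ u ∈ (Ico 1 T).filter (fun u => I u = k), ρ u :=
    Finset.sum_nonneg fun u _ => hρ u
  rcases U.eq_empty_or_nonempty with he | hne
  · rw [he]; simp only [Finset.sum_empty, Finset.card_empty]; positivity
  obtain ⟨a, ha, hamin⟩ := U.exists_min_image id hne
  obtain ⟨b, hb, hbmax⟩ := U.exists_max_image id hne
  simp only [id] at hamin hbmax
  have ha' := ha
  have hb' := hb
  simp only [hU, Finset.mem_filter, Finset.mem_Icc] at ha' hb'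
  have hab : a ≤ b := hamin b hb
  have hIcc : U = Ico a (b + 1) := by
    ext u
    constructor
    · intro hu; rw [Finset.mem_Ico]; exact ⟨hamin u hu, Nat.lt_succ_of_le (hbmax u hu)⟩
    · intro hu
      rw [Finset.mem_Ico] at hu
      have h1 := h.mono ha'.1.1 hu.1
      have h2 := h.mono (by omega : 1 ≤ u) (by omega : u ≤ b)
      simp only [hU, Finset.mem_filter, Finset.mem_Icc]
      omega
  obtain ⟨n, rfl⟩ := Nat.exists_eq_add_of_le hab
  have hmem : ∀ u, a ≤ u → u ≤ a + n → I u = k := fun u h1 h2 => by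
    have : u ∈ U := by rw [hIcc, Finset.mem_Ico]; omega
    exact (Finset.mem_filter.1 this).2
  have hblock := sum_Ico_le_of_dyadic_windows_of_le (g := g) (Δ := Δ k) hκ hδ a n
    (fun s i hs hi => h.keep s i (by omega) (by omega)
      ((hmem s hs (by have : 0 < 2 ^ i := by positivity
                      omega)).trans (hmem _ (hs.trans (Nat.le_add_right _ _)) hi).symm))
    (fun u hu => by
      rw [Finset.mem_Ico] at hu
      have := h.initialGap_le hρ (by omega : 1 ≤ u)
      rwa [hmem u hu.1 hu.2.le] at this)
  have hlast := h.gap_le hρ hb'.1.1 hb'.1.2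
  rw [hb'.2] at hlast
  have hone : 1 ≤ 1 / max (Δ k) δ := by
    rw [le_div_iff₀ hm, one_mul]; exact max_le (hΔ k) hδ1
  have hcard : (U.card : ℝ) = n + 1 := by
    rw [hIcc, Nat.card_Ico]; push_cast [show a + n + 1 - a = n + 1 by omega]; ring
  rw [hcard, hIcc, Finset.sum_Ico_succ_top hab]
  have h3 : 32 * κ ^ 2 / max (Δ k) δ = 32 * κ ^ 2 * (1 / max (Δ k) δ) := by ring
  have := hΔ k
  nlinarith

theorem sum_gap_le (h : ThresholdPath T δ κ I g Δ ρ) (hρ : ∀ t, 0 ≤ ρ t) (hκ : 0 ≤ κ)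
    (hδ : 0 < δ) (hδ1 : δ ≤ 1) (hΔ : ∀ k, Δ k ≤ 1) :
    ∑ u ∈ Icc 1 T, g u ≤
      2 * δ * T + (32 * κ ^ 2 + 1) * (∑ k ∈ range (I T + 1), 1 / max (Δ k) δ) +
        ∑ u ∈ Ico 1 T, ρ u := by
  have hmaps : ∀ u ∈ Icc 1 T, I u ∈ range (I T + 1) := fun u hu => by
    rw [Finset.mem_Icc] at hu
    rw [Finset.mem_range, Nat.lt_succ_iff]
    exact h.mono hu.1 hu.2
  have hmaps' : ∀ u ∈ Ico 1 T, I u ∈ range (I T + 1) := fun u hu => hmaps u <| by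
    rw [Finset.mem_Ico] at hu; rw [Finset.mem_Icc]; omega
  have hcard : (T : ℝ) = ∑ k ∈ range (I T + 1),
      (((Icc 1 T).filter (fun u => I u = k)).card : ℝ) := by
    rw [← Nat.cast_sum, ← Finset.card_eq_sum_card_fiberwise hmaps, Nat.card_Icc,
      Nat.add_sub_cancel]
  rw [← Finset.sum_fiberwise_of_maps_to hmaps g, ← Finset.sum_fiberwise_of_maps_to hmaps' ρ]
  conv_rhs => rw [hcard]
  rw [Finset.mul_sum, Finset.mul_sum, ← Finset.sum_add_distrib, ← Finset.sum_add_distrib]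
  exact Finset.sum_le_sum fun k _ => h.sum_gap_of_arm_le hρ hκ hδ hδ1 hΔ k

theorem rotting_of_replaced_arm (h : ThresholdPath T δ κ I g Δ ρ) (hρ : ∀ t, 0 ≤ ρ t)
    (hT : 1 ≤ T) {k : ℕ} (hk : k < I T) (hgood : Δ k < δ / 2) :
    δ / 2 < ∑ u ∈ (Ico 1 T).filter (fun u => I u = k), ρ u := by
  obtain ⟨s, h1, h2, h3, h4⟩ := h.exists_drop hT hk
  have h5 := h.drop s h1 h2 h4
  have h6 := h.gap_le hρ h1 h2.le
  rw [h3] at h6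
  linarith

theorem card_replaced_lt_of_slow (h : ThresholdPath T δ κ I g Δ ρ) (hρ : ∀ t, 0 ≤ ρ t)
    (hδ : 0 < δ) (hT : 1 ≤ T) {V : ℝ} (hV : ∑ u ∈ Ico 1 T, ρ u ≤ V) {M : ℕ}
    (hM : 2 * V / δ < M) :
    ((range (I T)).filter (fun k => Δ k < δ / 2)).card < M := by
  set G := (range (I T)).filter (fun k => Δ k < δ / 2) with hG
  have h1 : (G.card : ℝ) * (δ / 2) ≤ V := by
    calc (G.card : ℝ) * (δ / 2)
        ≤ ∑ k ∈ G, ∑ u ∈ (Ico 1 T).filter (fun u => I u = k), ρ u := by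
          rw [← nsmul_eq_mul]
          refine Finset.card_nsmul_le_sum _ _ _ fun k hk => ?_
          rw [hG, Finset.mem_filter, Finset.mem_range] at hk
          exact (h.rotting_of_replaced_arm hρ hT hk.1 hk.2).le
      _ ≤ ∑ u ∈ Ico 1 T, ρ u := Finset.sum_fiberwise_le_sum_of_sum_fiber_nonneg
          fun k _ => Finset.sum_nonneg fun u _ => hρ u
      _ ≤ V := hV
  have h2 : (G.card : ℝ) ≤ 2 * V / δ := by rw [le_div_iff₀ hδ]; linarith
  exact_mod_cast h2.trans_lt hM

/-- Every replaced good arm has rotted in some round, and a round belongs to one arm only. -/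
theorem card_replaced_le_of_abrupt (h : ThresholdPath T δ κ I g Δ ρ) (hρ : ∀ t, 0 ≤ ρ t)
    (hδ : 0 < δ) (hT : 1 ≤ T) :
    ((range (I T)).filter (fun k => Δ k < δ / 2)).card ≤
      ((Ico 1 T).filter fun t => ρ t ≠ 0).card := by
  have hsub : (range (I T)).filter (fun k => Δ k < δ / 2) ⊆
      ((Ico 1 T).filter fun t => ρ t ≠ 0).image I := by
    intro k hk
    rw [Finset.mem_filter, Finset.mem_range] at hk
    have h1 := h.rotting_of_replaced_arm hρ hT hk.1 hk.2
    obtain ⟨u, hu, hu0⟩ := Finset.exists_ne_zero_of_sum_ne_zero (by linarith :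
      ∑ u ∈ (Ico 1 T).filter (fun u => I u = k), ρ u ≠ 0)
    rw [Finset.mem_filter] at hu
    exact Finset.mem_image.2 ⟨u, Finset.mem_filter.2 ⟨hu.1, hu0⟩, hu.2⟩
  exact (Finset.card_le_card hsub).trans Finset.card_image_le

end ThresholdPath

/-! ### Structure of a run of the algorithm -/

section Run

variable {T : ℕ} {δ : ℝ} {sel : ℕ → 𝒜} {m : 𝒜 → ℝ} {η ρ : ℕ → ℝ}

/-- Position of the arm pulled in round `t`. -/
def idxAt (T : ℕ) (δ : ℝ) (sel : ℕ → 𝒜) (m : 𝒜 → ℝ) (η ρ : ℕ → ℝ) (t : ℕ) : ℕ :=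
  (run T δ sel m η ρ t).idx

/-- The gap of the arm pulled in round `t`. -/
def gapAt (T : ℕ) (δ : ℝ) (sel : ℕ → 𝒜) (m : 𝒜 → ℝ) (η ρ : ℕ → ℝ) (t : ℕ) : ℝ :=
  1 - (run T δ sel m η ρ (t - 1)).mean (sel (idxAt T δ sel m η ρ t))

theorem idxAt_succ (t : ℕ) : idxAt T δ sel m η ρ (t + 1) =
    if Withdraw T δ sel (t + 1) (run T δ sel m η ρ t) then idxAt T δ sel m η ρ t + 1
    else idxAt T δ sel m η ρ t := rfl

theorem run_succ_start (t : ℕ) : (run T δ sel m η ρ (t + 1)).start =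
    if Withdraw T δ sel (t + 1) (run T δ sel m η ρ t) then t + 1
    else (run T δ sel m η ρ t).start := rfl

theorem not_withdraw_one (η' ρ' : ℕ → ℝ) :
    ¬ Withdraw T δ sel 1 (run T δ sel m η' ρ' 0) := by
  rintro ⟨s, hs, -⟩
  have h1 : 1 ≤ s ∧ s < 1 :=
    ⟨(Finset.mem_Icc.1 (Finset.mem_filter.1 hs).1).1, (Finset.mem_filter.1 hs).2.2.1⟩
  omega

theorem idxAt_one : idxAt T δ sel m η ρ 1 = 0 := by
  rw [idxAt_succ 0, if_neg (not_withdraw_one η ρ)]; rfl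

theorem run_arm {t u : ℕ} (hu : 1 ≤ u) (hut : u ≤ t) :
    (run T δ sel m η ρ t).arm u = sel (idxAt T δ sel m η ρ u) := by
  induction t, hut using Nat.le_induction with
  | base =>
    obtain ⟨v, rfl⟩ := Nat.exists_eq_add_of_le' hu
    exact Function.update_self _ _ _
  | succ t ht ih =>
    rw [← ih]
    exact Function.update_of_ne (by omega) _ _

theorem run_rew {t u : ℕ} (hu : 1 ≤ u) (hut : u ≤ t) :
    (run T δ sel m η ρ t).rew u = 1 - gapAt T δ sel m η ρ u + η u := by
  induction t, hut using Nat.le_induction with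
  | base =>
    obtain ⟨v, rfl⟩ := Nat.exists_eq_add_of_le' hu
    rw [gapAt, sub_sub_cancel]
    exact Function.update_self _ _ _
  | succ t ht ih =>
    rw [← ih]
    exact Function.update_of_ne (by omega) _ _

theorem run_mean (hsel : Function.Injective sel) (t k : ℕ) :
    (run T δ sel m η ρ t).mean (sel k) =
      m (sel k) - ∑ u ∈ (Icc 1 t).filter (fun u => idxAt T δ sel m η ρ u = k), ρ u := by
  induction t with
  | zero => simp [run]
  | succ t ih =>
    have hstep : (run T δ sel m η ρ (t + 1)).mean = Function.update (run T δ sel m η ρ t).mean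
      (sel (idxAt T δ sel m η ρ (t + 1)))
      ((run T δ sel m η ρ t).mean (sel (idxAt T δ sel m η ρ (t + 1))) - ρ (t + 1)) := rfl
    rw [hstep, ← Finset.insert_Icc_right_eq_Icc_add_one (by omega), Finset.filter_insert]
    by_cases hk : idxAt T δ sel m η ρ (t + 1) = k
    · rw [if_pos hk, Finset.sum_insert (by simp), hk, Function.update_self, ih]
      ring
    · rw [if_neg hk, Function.update_of_ne (fun h => hk (hsel h).symm), ih]

/-- A window starting no earlier than `start` contains pulls of the current arm only. Monotonicity
of the positions is carried along in the induction because, at a replacement, it is what separates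
the new position from all earlier ones. -/
theorem run_start {t : ℕ} (ht : 1 ≤ t) :
    1 ≤ (run T δ sel m η ρ t).start ∧ (run T δ sel m η ρ t).start ≤ t ∧
      ∀ s, 1 ≤ s → s ≤ t → idxAt T δ sel m η ρ s ≤ idxAt T δ sel m η ρ t ∧
        ((run T δ sel m η ρ t).start ≤ s ↔ idxAt T δ sel m η ρ s = idxAt T δ sel m η ρ t) := by
  induction t, ht using Nat.le_induction with
  | base =>
    rw [run_succ_start 0, if_neg (not_withdraw_one η ρ)]
    refine ⟨le_rfl, le_rfl, fun s h1 h2 => ?_⟩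
    obtain rfl : s = 1 := by omega
    simp [run]
  | succ t ht ih =>
    obtain ⟨h1, h2, h3⟩ := ih
    by_cases hW : Withdraw T δ sel (t + 1) (run T δ sel m η ρ t)
    · have hi := idxAt_succ (T := T) (δ := δ) (sel := sel) (m := m) (η := η) (ρ := ρ) t
      rw [if_pos hW] at hi
      rw [run_succ_start, if_pos hW]
      refine ⟨by omega, le_rfl, fun s hs hst => ?_⟩
      rcases Nat.lt_or_ge t s with hlt | hge
      · obtain rfl : s = t + 1 := by omega
        simp
      · have := (h3 s hs hge).1
        omega
    · have hi := idxAt_succ (T := T) (δ := δ) (sel := sel) (m := m) (η := η) (ρ := ρ) t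
      rw [if_neg hW] at hi
      rw [run_succ_start, if_neg hW, hi]
      refine ⟨h1, by omega, fun s hs hst => ?_⟩
      rcases Nat.lt_or_ge t s with hlt | hge
      · obtain rfl : s = t + 1 := by omega
        rw [hi]; simp; omega
      · exact h3 s hs hge

theorem regret_eq_sum_gapAt :
    regret T δ sel m η ρ = ∑ t ∈ Icc 1 T, gapAt T δ sel m η ρ t := by
  refine Finset.sum_congr rfl fun t ht => ?_
  rw [armAt, run_arm (Finset.mem_Icc.1 ht).1 le_rfl]
  rfl

theorem gapAt_eq (hsel : Function.Injective sel) {t : ℕ} (ht : 1 ≤ t) :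
    gapAt T δ sel m η ρ t = (1 - m (sel (idxAt T δ sel m η ρ t))) +
      ∑ u ∈ (Ico 1 t).filter
        (fun u => idxAt T δ sel m η ρ u = idxAt T δ sel m η ρ t), ρ u := by
  obtain ⟨v, rfl⟩ := Nat.exists_eq_add_of_le' ht
  rw [gapAt, run_mean hsel, Nat.add_sub_cancel,
    show Icc 1 v = Ico 1 (v + 1) by ext; simp]
  ring

/-- Within the use of one arm the pull count equals the window length, so the index splits into
average gap, average noise and confidence radius. -/
theorem wucb_run {s t : ℕ} (hs : 1 ≤ s) (hst : s ≤ t)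
    (hstart : (run T δ sel m η ρ t).start ≤ s) :
    wucb T (run T δ sel m η ρ t).arm (run T δ sel m η ρ t).rew (sel (run T δ sel m η ρ t).idx) s t =
      1 - (∑ u ∈ Icc s t, gapAt T δ sel m η ρ u) / (t + 1 - s : ℕ) +
        (∑ u ∈ Icc s t, η u) / (t + 1 - s : ℕ) + √(12 * Real.log T / (t + 1 - s : ℕ)) := by
  have harm : ∀ u ∈ Icc s t,
      (run T δ sel m η ρ t).arm u = sel (run T δ sel m η ρ t).idx := fun u hu => by
    rw [Finset.mem_Icc] at hu
    rw [run_arm (by omega) hu.2]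
    congr 1
    exact (((run_start (hs.trans hst)).2.2 u (by omega) hu.2).2).1 (by omega)
  have hcount : pullCount (run T δ sel m η ρ t).arm (sel (run T δ sel m η ρ t).idx) s t
      = t + 1 - s := by
    rw [pullCount, Finset.filter_true_of_mem harm, Nat.card_Icc]
  have hpos : ((t + 1 - s : ℕ) : ℝ) ≠ 0 := by
    have : t + 1 - s ≠ 0 := by omega
    exact_mod_cast this
  rw [wucb, empMean, hcount]
  congr 1
  have : (∑ u ∈ Icc s t, if (run T δ sel m η ρ t).arm u = sel (run T δ sel m η ρ t).idx
      then (run T δ sel m η ρ t).rew u else 0) =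
      ∑ u ∈ Icc s t, (1 - gapAt T δ sel m η ρ u + η u) := by
    refine Finset.sum_congr rfl fun u hu => ?_
    rw [if_pos (harm u hu)]
    rw [Finset.mem_Icc] at hu
    exact run_rew (by omega) hu.2
  rw [this, Finset.sum_add_distrib, Finset.sum_sub_distrib, Finset.sum_const, Nat.card_Icc,
    nsmul_eq_mul, mul_one]
  field_simp

/-- The noise stays within its confidence width on all windows up to the horizon. -/
def GoodNoise (T : ℕ) (η : ℕ → ℝ) : Prop :=
  ∀ s ∈ Icc 1 T, ∀ t ∈ Icc s T, |∑ u ∈ Icc s t, η u| ≤ √(12 * Real.log T * (t + 1 - s : ℕ))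

/-- The factor `2` in `2 * √(12 * Real.log T)` counts one width for the radius in the index and one
for the noise. For a replacement, the noise is at worst cancelled by the radius, so the average gap
itself exceeds `δ`. -/
theorem thresholdPath_run (hsel : Function.Injective sel) (hρ : ∀ t, 0 ≤ ρ t)
    (hη : GoodNoise T η) :
    ThresholdPath T δ (2 * √(12 * Real.log T)) (idxAt T δ sel m η ρ) (gapAt T δ sel m η ρ)
      (fun k => 1 - m (sel k)) ρ where
  one := idxAt_one
  step t _ := by rw [idxAt_succ]; split_ifs <;> simp
  gap t ht := gapAt_eq hsel ht
  keep s i hs hsT hI := by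
    have hpow : 0 < 2 ^ i := by positivity
    obtain ⟨t, ht⟩ : ∃ t, s + 2 ^ i = t + 1 := ⟨s + 2 ^ i - 1, by omega⟩
    rw [ht] at hI hsT ⊢
    have hst : s ≤ t := by omega
    have hst0 := run_start (T := T) (δ := δ) (sel := sel) (m := m) (η := η) (ρ := ρ) (hs.trans hst)
    have hle := (hst0.2.2 s hs hst).1
    have hnot : ¬ Withdraw T δ sel (t + 1) (run T δ sel m η ρ t) := fun hW => by
      rw [idxAt_succ, if_pos hW] at hI; omega
    rw [idxAt_succ, if_neg hnot] at hI
    have hstart := ((hst0.2.2 s hs hst).2).2 hI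
    simp only [Withdraw, not_exists, not_and, not_lt] at hnot
    have hw := hnot s (by
      simp only [windowStarts, Finset.mem_filter, Finset.mem_Icc]
      exact ⟨by omega, hstart, by omega, i, ht⟩)
    rw [Nat.add_sub_cancel, wucb_run hs hst hstart, show t + 1 - s = 2 ^ i by omega] at hw
    have hn := (abs_le.1 (hη s (by rw [Finset.mem_Icc]; omega) t
      (by rw [Finset.mem_Icc]; omega))).2
    rw [show t + 1 - s = 2 ^ i by omega] at hn
    rw [show Ico s (t + 1) = Icc s t by ext; simp]
    push_cast at hw hn
    have hL : 0 ≤ 12 * Real.log T := by have := Real.log_natCast_nonneg T; positivity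
    rw [Real.sqrt_mul hL] at hn
    rw [Real.sqrt_div hL] at hw
    have hx : 0 < √((2 : ℝ) ^ i) := by positivity
    have hx2 : √((2 : ℝ) ^ i) ^ 2 = 2 ^ i := Real.sq_sqrt (by positivity)
    rw [← hx2, Real.sqrt_sq hx.le] at hw ⊢
    set x := √((2 : ℝ) ^ i)
    set w := √(12 * Real.log T)
    set G := ∑ u ∈ Icc s t, gapAt T δ sel m η ρ u
    set N := ∑ u ∈ Icc s t, η u
    have h1 : (1 - G / x ^ 2 + N / x ^ 2 + w / x) * x ^ 2 = x ^ 2 - G + N + w * x := by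
      field_simp
    have h2 := mul_le_mul_of_nonneg_right hw (by positivity : 0 ≤ x ^ 2)
    rw [h1] at h2
    linarith
  drop t ht htT hI := by
    have hst0 := run_start (T := T) (δ := δ) (sel := sel) (m := m) (η := η) (ρ := ρ) ht
    have hW : Withdraw T δ sel (t + 1) (run T δ sel m η ρ t) := by
      by_contra hW
      rw [idxAt_succ, if_neg hW] at hI; omega
    obtain ⟨s, hs, hw⟩ := hW
    simp only [windowStarts, Finset.mem_filter, Finset.mem_Icc] at hs
    obtain ⟨⟨hs1, -⟩, hstart, hst, -⟩ := hs
    rw [Nat.add_sub_cancel, wucb_run hs1 (by omega) hstart] at hw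
    have hn := (abs_le.1 (hη s (by rw [Finset.mem_Icc]; omega) t
      (by rw [Finset.mem_Icc]; omega))).1
    have hL : 0 ≤ 12 * Real.log T := by have := Real.log_natCast_nonneg T; positivity
    have hnpos : 0 < t + 1 - s := by omega
    have hcard : (Icc s t).card = t + 1 - s := Nat.card_Icc s t
    -- Rotting is nonnegative, so the gap of an arm in use never decreases: the current gap
    -- dominates the window average.
    have hG : ∑ u ∈ Icc s t, gapAt T δ sel m η ρ u ≤
        (t + 1 - s : ℕ) * gapAt T δ sel m η ρ t := by
      rw [← nsmul_eq_mul, ← hcard]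
      refine Finset.sum_le_card_nsmul _ _ _ fun u hu => ?_
      rw [Finset.mem_Icc] at hu
      have hIu := ((hst0.2.2 u (by omega) hu.2).2).1 (by omega)
      rw [gapAt_eq hsel (by omega : 1 ≤ u), gapAt_eq hsel ht, hIu]
      refine add_le_add_right (Finset.sum_le_sum_of_subset_of_nonneg ?_ fun u _ _ => hρ u) _
      exact Finset.filter_subset_filter _ (Finset.Ico_subset_Ico le_rfl hu.2)
    have hnposR : (0 : ℝ) < (t + 1 - s : ℕ) := by exact_mod_cast hnpos
    rw [Real.sqrt_mul hL] at hn
    rw [Real.sqrt_div hL] at hw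
    have hx : 0 < √((t + 1 - s : ℕ) : ℝ) := Real.sqrt_pos.2 hnposR
    have hx2 : √((t + 1 - s : ℕ) : ℝ) ^ 2 = (t + 1 - s : ℕ) := Real.sq_sqrt hnposR.le
    rw [← hx2] at hG
    rw [← hx2, Real.sqrt_sq hx.le] at hw
    set x := √((t + 1 - s : ℕ) : ℝ)
    set w := √(12 * Real.log T)
    set G := ∑ u ∈ Icc s t, gapAt T δ sel m η ρ u
    set N := ∑ u ∈ Icc s t, η u
    have h1 : (1 - G / x ^ 2 + N / x ^ 2 + w / x) * x ^ 2 = x ^ 2 - G + N + w * x := by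
      field_simp
    have h2 := mul_lt_mul_of_pos_right hw (by positivity : 0 < x ^ 2)
    rw [h1] at h2
    have h3 : x ^ 2 * δ < x ^ 2 * gapAt T δ sel m η ρ t := by linarith
    exact lt_of_mul_lt_mul_left h3 (by positivity)

end Run

/-! ### Concentration of the noise -/

namespace SubGaussianNoise

variable [mΩ : MeasurableSpace Ω] {P : Measure Ω} {ℱ : Filtration ℕ mΩ} {η : ℕ → Ω → ℝ}

theorem measurable (h : SubGaussianNoise P ℱ η) (t : ℕ) : Measurable (η t) :=
  (h.adapted t).mono (ℱ.le t) le_rfl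

theorem measurable_sum (h : SubGaussianNoise P ℱ η) (A : Finset ℕ) :
    Measurable fun ω => ∑ u ∈ A, η u ω :=
  Finset.measurable_sum A fun u _ => h.measurable u

theorem measurableSet_goodNoise (h : SubGaussianNoise P ℱ η) (T : ℕ) :
    MeasurableSet {ω | GoodNoise T fun t => η t ω} := by
  simp only [GoodNoise, Set.ofPred_forall]
  exact Finset.measurableSet_biInter _ fun s _ => Finset.measurableSet_biInter _ fun t _ =>
    measurableSet_le (h.measurable_sum _).abs measurable_const

variable [IsProbabilityMeasure P]

/-- The product of exponentials is dominated via `ab ≤ a² + b²`. Squaring doubles `z`, which is why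
the induction hypothesis must cover all `z`. -/
theorem integrable_exp_sum (h : SubGaussianNoise P ℱ η) (s n : ℕ) : ∀ z : ℝ,
    Integrable (fun ω => Real.exp (z * ∑ u ∈ Ico (s + 1) (s + 1 + n), η u ω)) P := by
  induction n with
  | zero => intro z; simp
  | succ n ih =>
    intro z
    refine ((ih (2 * z)).add (h.integrable_exp (s + n) (2 * z))).mono'
      (Real.measurable_exp.comp
        ((h.measurable_sum _).const_mul z)).aestronglyMeasurable (.of_forall fun ω => ?_)
    rw [Real.norm_eq_abs, Real.abs_exp, ← add_assoc,
      Finset.sum_Ico_succ_top (by omega : s + 1 ≤ s + 1 + n), mul_add, Real.exp_add]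
    simp only [Pi.add_apply]
    rw [show s + 1 + n = s + n + 1 by omega, mul_assoc, mul_assoc, two_mul, Real.exp_add, two_mul,
      Real.exp_add]
    nlinarith [sq_nonneg (Real.exp (z * ∑ u ∈ Ico (s + 1) (s + n + 1), η u ω) -
      Real.exp (z * η (s + n + 1) ω)), Real.exp_pos (z * ∑ u ∈ Ico (s + 1) (s + n + 1), η u ω),
      Real.exp_pos (z * η (s + n + 1) ω)]

/-- Conditioning on `ℱ (s + n)` peels off the last noise term. Windows start at `s + 1` because the
noise assumption concerns `η (t + 1)` given `ℱ t` and says nothing about the moments of `η 0`. -/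
theorem mgf_sum_le (h : SubGaussianNoise P ℱ η) (s n : ℕ) (z : ℝ) :
    mgf (fun ω => ∑ u ∈ Ico (s + 1) (s + 1 + n), η u ω) P z ≤ Real.exp (n * z ^ 2 / 2) := by
  induction n with
  | zero => simp [mgf]
  | succ n ih =>
    set f : Ω → ℝ := fun ω => Real.exp (z * ∑ u ∈ Ico (s + 1) (s + 1 + n), η u ω) with hf
    set g : Ω → ℝ := fun ω => Real.exp (z * η (s + n + 1) ω) with hg
    have hfg : (fun ω => Real.exp (z * ∑ u ∈ Ico (s + 1) (s + 1 + (n + 1)), η u ω)) = f * g := by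
      funext ω
      rw [← add_assoc, Finset.sum_Ico_succ_top (by omega : s + 1 ≤ s + 1 + n), mul_add,
        Real.exp_add, show s + 1 + n = s + n + 1 by omega]
      simp only [Pi.mul_apply, hf, hg, show s + 1 + n = s + n + 1 by omega]
    have hint : Integrable (f * g) P := hfg ▸ h.integrable_exp_sum s (n + 1) z
    have hgint : Integrable g P := h.integrable_exp (s + n) z
    have hfint : Integrable f P := h.integrable_exp_sum s n z
    have hfm : StronglyMeasurable[ℱ (s + n)] f := by
      refine (Real.measurable_exp.comp (Measurable.const_mul ?_ z)).stronglyMeasurable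
      refine Finset.measurable_sum _ fun u hu => ?_
      rw [Finset.mem_Ico] at hu
      exact (h.adapted u).mono (ℱ.mono (by omega)) le_rfl
    have hpull := condExp_mul_of_stronglyMeasurable_left hfm hint hgint
    have hcond := h.condExp_exp_le (s + n) z
    calc mgf (fun ω => ∑ u ∈ Ico (s + 1) (s + 1 + (n + 1)), η u ω) P z
        = ∫ ω, (f * g) ω ∂P := by rw [mgf, hfg]
      _ = ∫ ω, (P[f * g | ℱ (s + n)]) ω ∂P := (integral_condExp (ℱ.le _)).symm
      _ ≤ ∫ ω, f ω * Real.exp (z ^ 2 / 2) ∂P := by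
          refine integral_mono_ae integrable_condExp (hfint.mul_const _) ?_
          filter_upwards [hpull, hcond] with ω h1 h2
          rw [h1]
          exact mul_le_mul_of_nonneg_left h2 (Real.exp_pos _).le
      _ = mgf (fun ω => ∑ u ∈ Ico (s + 1) (s + 1 + n), η u ω) P z * Real.exp (z ^ 2 / 2) :=
          integral_mul_const _ _
      _ ≤ Real.exp (n * z ^ 2 / 2) * Real.exp (z ^ 2 / 2) :=
          mul_le_mul_of_nonneg_right ih (Real.exp_pos _).le
      _ = Real.exp ((n + 1 : ℕ) * z ^ 2 / 2) := by
          rw [← Real.exp_add]; congr 1; push_cast; ring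

theorem measureReal_abs_sum_gt_le (h : SubGaussianNoise P ℱ η) {s t : ℕ} (hs : 1 ≤ s)
    (hst : s ≤ t) {L : ℝ} (hL : 0 ≤ L) :
    P.real {ω | √(12 * L * (t + 1 - s : ℕ)) < |∑ u ∈ Icc s t, η u ω|} ≤
      2 * Real.exp (-(6 * L)) := by
  obtain ⟨r, rfl⟩ := Nat.exists_eq_add_of_le' hs
  obtain ⟨n, rfl⟩ := Nat.exists_eq_add_of_le hst
  have hI : Icc (r + 1) (r + 1 + n) = Ico (r + 1) (r + 1 + (n + 1)) := by ext; simp; omega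
  rw [hI, show r + 1 + n + 1 - (r + 1) = n + 1 by omega]
  set X : Ω → ℝ := fun ω => ∑ u ∈ Ico (r + 1) (r + 1 + (n + 1)), η u ω
  set ε := √(12 * L * (n + 1 : ℕ)) with hε
  have hn : (0 : ℝ) < (n + 1 : ℕ) := by positivity
  have hε2 : ε ^ 2 = 12 * L * (n + 1 : ℕ) := Real.sq_sqrt (by positivity)
  have hε0 : 0 ≤ ε := Real.sqrt_nonneg _
  -- This `z` minimises the Chernoff exponent `-zε + (n + 1)z²/2`, with minimum `-ε² / (2(n + 1)) =
  -- -6L`.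
  set z := ε / (n + 1 : ℕ)
  have hz0 : 0 ≤ z := by positivity
  have hexp : -z * ε + (n + 1 : ℕ) * z ^ 2 / 2 = -(6 * L) := by
    have : z * (n + 1 : ℕ) = ε := by simp only [z]; field_simp
    have h2 : z * ε = 12 * L := by
      simp only [z]; rw [div_mul_eq_mul_div, ← pow_two, hε2]; field_simp
    nlinarith
  have hup : P.real {ω | ε ≤ X ω} ≤ Real.exp (-(6 * L)) := by
    refine (measure_ge_le_exp_mul_mgf ε hz0 (h.integrable_exp_sum r (n + 1) z)).trans ?_
    rw [← hexp, Real.exp_add]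
    exact mul_le_mul_of_nonneg_left (h.mgf_sum_le r (n + 1) z) (Real.exp_pos _).le
  have hdown : P.real {ω | X ω ≤ -ε} ≤ Real.exp (-(6 * L)) := by
    refine (measure_le_le_exp_mul_mgf (-ε) (neg_nonpos.2 hz0)
      (h.integrable_exp_sum r (n + 1) (-z))).trans ?_
    have := h.mgf_sum_le r (n + 1) (-z)
    rw [neg_sq] at this
    rw [← hexp, Real.exp_add, neg_neg, mul_neg, ← neg_mul]
    exact mul_le_mul_of_nonneg_left this (Real.exp_pos _).le
  have hsub : {ω | ε < |X ω|} ⊆ {ω | ε ≤ X ω} ∪ {ω | X ω ≤ -ε} := fun ω hω => by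
    rw [Set.mem_ofPred_eq] at hω
    rcases lt_abs.1 hω with h1 | h1
    · exact Or.inl h1.le
    · exact Or.inr (by simp only [Set.mem_ofPred_eq]; linarith)
  calc P.real {ω | ε < |X ω|} ≤ P.real ({ω | ε ≤ X ω} ∪ {ω | X ω ≤ -ε}) := measureReal_mono hsub
    _ ≤ P.real {ω | ε ≤ X ω} + P.real {ω | X ω ≤ -ε} := measureReal_union_le _ _
    _ ≤ 2 * Real.exp (-(6 * L)) := by linarith

/-- The windows consist of rounds rather than of pulls of a given arm, so they are deterministic. A
union bound over at most `T ^ 2` of them, each failing with probability at most `2 / T ^ 6`,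
suffices. -/
theorem measureReal_not_goodNoise_le (h : SubGaussianNoise P ℱ η) {T : ℕ} (hT : 1 ≤ T) :
    P.real {ω | ¬ GoodNoise T fun t => η t ω} ≤ 2 / (T : ℝ) ^ 4 := by
  have hsub : {ω | ¬ GoodNoise T fun t => η t ω} = ⋃ s ∈ Icc 1 T, ⋃ t ∈ Icc s T,
      {ω | √(12 * Real.log T * (t + 1 - s : ℕ)) < |∑ u ∈ Icc s t, η u ω|} := by
    ext ω
    simp only [GoodNoise, Set.mem_ofPred_eq, Set.mem_iUnion, not_forall, not_le]
  have hT0 : (0 : ℝ) < T := by exact_mod_cast hT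
  have hexp : Real.exp (-(6 * Real.log T)) = ((T : ℝ) ^ 6)⁻¹ := by
    rw [Real.exp_neg, show (6 : ℝ) * Real.log T = (6 : ℕ) * Real.log T by norm_num,
      Real.exp_nat_mul, Real.exp_log hT0]
  rw [hsub]
  calc _ ≤ ∑ s ∈ Icc 1 T, P.real (⋃ t ∈ Icc s T,
      {ω | √(12 * Real.log T * (t + 1 - s : ℕ)) < |∑ u ∈ Icc s t, η u ω|}) :=
        measureReal_biUnion_finset_le _ _
    _ ≤ ∑ s ∈ Icc 1 T, (T : ℝ) * (2 * Real.exp (-(6 * Real.log T))) := by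
        refine Finset.sum_le_sum fun s hs => (measureReal_biUnion_finset_le _ _).trans ?_
        rw [Finset.mem_Icc] at hs
        refine (Finset.sum_le_card_nsmul _ _ (2 * Real.exp (-(6 * Real.log T))) fun t ht => ?_).trans ?_
        · exact h.measureReal_abs_sum_gt_le hs.1 (Finset.mem_Icc.1 ht).1
            (Real.log_natCast_nonneg T)
        · rw [nsmul_eq_mul]
          refine mul_le_mul_of_nonneg_right ?_ (by positivity)
          rw [Nat.card_Icc]
          exact_mod_cast (by omega : T + 1 - s ≤ T)
    _ = 2 / (T : ℝ) ^ 4 := by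
        rw [Finset.sum_const, Nat.card_Icc, Nat.add_sub_cancel, nsmul_eq_mul, hexp]
        field_simp

end SubGaussianNoise

/-! ### Measurability of the regret -/

section Measurability

variable [MeasurableSpace Ω]

/-- Random arms are addressed through their countably many positions, so no measurable structure on
`𝒜` is needed. -/
theorem measurable_eval_nat {f : ℕ → Ω → ℝ} {n : Ω → ℕ} (hf : ∀ k, Measurable (f k))
    (hn : Measurable n) : Measurable fun ω => f (n ω) ω :=
  (measurable_from_prod_countable_left (f := fun p : Ω × ℕ => f p.2 p.1) hf).comp
    (measurable_id.prodMk hn)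

/-- All data of a random configuration are measurable. -/
structure MeasurableConfig (c : Ω → Config 𝒜) : Prop where
  idx : Measurable fun ω => (c ω).idx
  start : Measurable fun ω => (c ω).start
  arm : ∀ u b, MeasurableSet {ω | (c ω).arm u = b}
  rew : ∀ u, Measurable fun ω => (c ω).rew u
  mean : ∀ b, Measurable fun ω => (c ω).mean b

namespace MeasurableConfig

variable {c : Ω → Config 𝒜}

theorem wucb (h : MeasurableConfig c) (T : ℕ) (b : 𝒜) (t₁ t₂ : ℕ) :
    Measurable fun ω => RottingBandit.wucb T (c ω).arm (c ω).rew b t₁ t₂ := by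
  have hcount : Measurable fun ω => (pullCount (c ω).arm b t₁ t₂ : ℝ) := by
    simp only [pullCount, Finset.card_filter, Nat.cast_sum]
    refine Finset.measurable_sum _ fun u _ => ?_
    simp only [Nat.cast_ite]
    exact Measurable.ite (h.arm u b) measurable_const measurable_const
  unfold RottingBandit.wucb empMean
  refine Measurable.add (Measurable.div ?_ hcount) (measurable_const.div hcount).sqrt
  exact Finset.measurable_sum _ fun u _ => Measurable.ite (h.arm u b) (h.rew u) measurable_const

theorem withdraw (h : MeasurableConfig c) (T : ℕ) (δ : ℝ) (sel : ℕ → 𝒜) (t : ℕ) :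
    MeasurableSet {ω | Withdraw T δ sel t (c ω)} := by
  -- Fixing the values of `idx` and `start` makes both the tested arm and the set of windows
  -- deterministic.
  have : {ω | Withdraw T δ sel t (c ω)} = ⋃ k : ℕ, ⋃ r : ℕ,
      ({ω | (c ω).idx = k} ∩ {ω | (c ω).start = r}) ∩ ⋃ s ∈ windowStarts T r t,
        {ω | RottingBandit.wucb T (c ω).arm (c ω).rew (sel k) s (t - 1) < 1 - δ} := by
    ext ω
    simp [Withdraw]
  rw [this]
  exact .iUnion fun k => .iUnion fun r =>
    ((h.idx (measurableSet_singleton k)).inter (h.start (measurableSet_singleton r))).inter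
      (Finset.measurableSet_biUnion _ fun s _ =>
        measurableSet_lt (h.wucb T (sel k) s (t - 1)) measurable_const)

theorem nextIdx (h : MeasurableConfig c) (T : ℕ) (δ : ℝ) (sel : ℕ → 𝒜) (t : ℕ) :
    Measurable fun ω => RottingBandit.nextIdx T δ sel t (c ω) :=
  Measurable.ite (h.withdraw T δ sel t) (h.idx.add_const 1) h.idx

theorem playRound (h : MeasurableConfig c) (T : ℕ) (δ : ℝ) (sel : ℕ → 𝒜) {η ρ : ℕ → Ω → ℝ}
    (hη : ∀ t, Measurable (η t)) (hρ : ∀ t, Measurable (ρ t)) (t : ℕ) :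
    MeasurableConfig fun ω =>
      RottingBandit.playRound T δ sel (fun t => η t ω) (fun t => ρ t ω) t (c ω) := by
  have hn := h.nextIdx T δ sel t
  have hset : ∀ b, MeasurableSet {ω | sel (RottingBandit.nextIdx T δ sel t (c ω)) = b} :=
    fun b => hn (MeasurableSet.of_discrete (s := {k : ℕ | sel k = b}))
  have hmean : Measurable fun ω => (c ω).mean (sel (RottingBandit.nextIdx T δ sel t (c ω))) :=
    measurable_eval_nat (f := fun k ω => (c ω).mean (sel k)) (fun k => h.mean (sel k)) hn
  refine ⟨hn, Measurable.ite (h.withdraw T δ sel t) measurable_const h.start,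
    fun u b => ?_, fun u => ?_, fun b => ?_⟩
  · by_cases hu : u = t
    · subst hu
      simpa [RottingBandit.playRound] using hset b
    · simpa [RottingBandit.playRound, hu] using h.arm u b
  · by_cases hu : u = t
    · subst hu
      simpa [RottingBandit.playRound] using hmean.fun_add (hη u)
    · simpa [RottingBandit.playRound, hu] using h.rew u
  · simp only [RottingBandit.playRound, Function.update_apply]
    refine Measurable.ite ?_ (hmean.sub (hρ t)) (h.mean b)
    simpa only [eq_comm] using hset b

end MeasurableConfig

theorem measurableConfig_run (T : ℕ) (δ : ℝ) (sel : ℕ → 𝒜) {μ₁ : 𝒜 → Ω → ℝ} {η ρ : ℕ → Ω → ℝ}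
    (hμ : ∀ a, Measurable (μ₁ a)) (hη : ∀ t, Measurable (η t)) (hρ : ∀ t, Measurable (ρ t))
    (t : ℕ) : MeasurableConfig fun ω =>
      run T δ sel (fun a => μ₁ a ω) (fun t => η t ω) (fun t => ρ t ω) t := by
  induction t with
  | zero => exact ⟨measurable_const, measurable_const, fun u b => MeasurableSet.const (sel 0 = b),
      fun _ => measurable_const, hμ⟩
  | succ t ih => exact ih.playRound T δ sel hη hρ (t + 1)

theorem measurable_regret (T : ℕ) (δ : ℝ) (sel : ℕ → 𝒜) {μ₁ : 𝒜 → Ω → ℝ} {η ρ : ℕ → Ω → ℝ}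
    (hμ : ∀ a, Measurable (μ₁ a)) (hη : ∀ t, Measurable (η t)) (hρ : ∀ t, Measurable (ρ t)) :
    Measurable fun ω =>
      regret T δ sel (fun a => μ₁ a ω) (fun t => η t ω) (fun t => ρ t ω) := by
  simp only [regret_eq_sum_gapAt]
  refine Finset.measurable_sum _ fun t _ => measurable_const.sub ?_
  exact measurable_eval_nat
    (f := fun k ω => (run T δ sel (fun a => μ₁ a ω) (fun t => η t ω) (fun t => ρ t ω)
      (t - 1)).mean (sel k))
    (fun k => (measurableConfig_run T δ sel hμ hη hρ (t - 1)).mean (sel k))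
    (measurableConfig_run T δ sel hμ hη hρ t).idx

end Measurability

/-! ### Sampling arms until enough good ones are found -/

/-- The number of indices below `k` whose value is in `A`. -/
def hitCount (A : Set ℝ) (y : ℕ → ℝ) (k : ℕ) : ℕ := ((range k).filter fun j => y j ∈ A).card

theorem hitCount_succ (A : Set ℝ) (y : ℕ → ℝ) (k : ℕ) :
    hitCount A y (k + 1) = hitCount A y k + if y k ∈ A then 1 else 0 := by
  rw [hitCount, Finset.range_add_one, Finset.filter_insert]
  split_ifs with h
  · rw [Finset.card_insert_of_notMem (by simp)]; rfl
  · rfl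

theorem sum_hits_le (A : Set ℝ) (y : ℕ → ℝ) (M n : ℕ) :
    ∑ k ∈ range n, ((if y k ∈ A then 1 else 0) * if hitCount A y k < M then 1 else 0 : ℝ) ≤ M := by
  -- A hit counts only if fewer than `M` preceded it. The induction needs the sharper bound by
  -- `min`, since `M` alone does not show that the sum can still grow.
  suffices h : ∑ k ∈ range n, ((if y k ∈ A then 1 else 0) * if hitCount A y k < M then 1 else 0) ≤
      min (hitCount A y n) M by
    have := h.trans (min_le_right _ _)
    exact_mod_cast this
  induction n with
  | zero => simp
  | succ n ih =>
    rw [Finset.sum_range_succ, hitCount_succ]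
    split_ifs <;> omega

section Sampling

variable [MeasurableSpace Ω] {P : Measure Ω} {Y : ℕ → Ω → ℝ}

theorem measurable_hitCount_lt {A : Set ℝ} (hA : MeasurableSet A) {α : Type*} [MeasurableSpace α]
    {f : ℕ → α → ℝ} (M k : ℕ) (hf : ∀ j < k, Measurable (f j)) :
    Measurable fun x => (if hitCount A (fun j => f j x) k < M then 1 else 0 : ℝ) := by
  refine Measurable.ite ?_ measurable_const measurable_const
  refine measurableSet_lt ?_ measurable_const
  simp only [hitCount, Finset.card_filter]
  refine Finset.measurable_sum _ fun j hj => ?_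
  exact Measurable.ite ((hf j (Finset.mem_range.1 hj)) hA) measurable_const measurable_const

/-- The event that sampling is still running at `k` depends on the earlier values only; this is the
predictability behind Wald's identity. -/
theorem indepFun_hitCount_lt (hind : iIndepFun Y P) (hY : ∀ k, Measurable (Y k)) {A : Set ℝ}
    (hA : MeasurableSet A) (M k : ℕ) :
    IndepFun (Y k) (fun ω => (if hitCount A (fun j => Y j ω) k < M then 1 else 0 : ℝ)) P := by
  have h := hind.indepFun_finset {k} (range k) (by simp) hY
  -- The default `0` is never read, since `hitCount` at `k` inspects only indices below `k`.
  have hψ : Measurable fun x : (range k → ℝ) =>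
      (if hitCount A (fun j => if hj : j ∈ range k then x ⟨j, hj⟩ else 0) k < M
        then 1 else 0 : ℝ) :=
    measurable_hitCount_lt (f := fun j (x : range k → ℝ) => if hj : j ∈ range k then x ⟨j, hj⟩ else 0)
      hA M k fun j hj => by
        simp only [Finset.mem_range.2 hj, dif_pos]
        exact measurable_pi_apply _
  have h2 := h.comp (measurable_pi_apply (⟨k, by simp⟩ : ({k} : Finset ℕ))) hψ
  have hcount : ∀ ω, hitCount A (fun j => Y j ω) k =
      hitCount A (fun j => if hj : j ∈ range k then Y j ω else 0) k := fun ω => by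
    unfold hitCount
    congr 1
    refine Finset.filter_congr fun j hj => ?_
    simp only [hj, dite_true]
  simp only [hcount]
  exact h2

variable [IsProbabilityMeasure P]

theorem integrable_mul_hitCount_lt (hY : ∀ k, Measurable (Y k)) {A : Set ℝ}
    (hA : MeasurableSet A) {φ : ℝ → ℝ} (hφ : Measurable φ) {c : ℝ} (hφ0 : ∀ y, 0 ≤ φ y)
    (hφc : ∀ y, φ y ≤ c) (M k : ℕ) :
    Integrable (fun ω => φ (Y k ω) *
      if hitCount A (fun j => Y j ω) k < M then 1 else 0) P := by
  refine Integrable.of_bound ((hφ.comp (hY k)).mul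
    (measurable_hitCount_lt hA M k fun j _ => hY j)).aestronglyMeasurable c (.of_forall fun ω => ?_)
  have h1 := hφ0 (Y k ω)
  have h2 := hφc (Y k ω)
  rw [Real.norm_eq_abs]
  split_ifs
  · rw [mul_one, abs_of_nonneg h1]; exact h2
  · rw [mul_zero, abs_zero]; exact h1.trans h2

/-- A Wald-type bound: if one samples independent values until `M` of them fall in `A`, the expected
sum of a nonnegative function of the samples is at most `M * B / p`. -/
theorem integral_sum_until_hits_le (hind : iIndepFun Y P) (hY : ∀ k, Measurable (Y k)) {A : Set ℝ}
    (hA : MeasurableSet A) {φ : ℝ → ℝ} (hφ : Measurable φ) {c : ℝ} (hφ0 : ∀ y, 0 ≤ φ y)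
    (hφc : ∀ y, φ y ≤ c) {p B : ℝ} (hp : 0 < p) (hpA : ∀ k, p ≤ P.real {ω | Y k ω ∈ A})
    (hB : ∀ k, ∫ ω, φ (Y k ω) ∂P ≤ B) (M n : ℕ) :
    ∫ ω, ∑ k ∈ range n, φ (Y k ω) *
      (if hitCount A (fun j => Y j ω) k < M then 1 else 0) ∂P ≤ M * B / p := by
  set e : ℕ → Ω → ℝ := fun k ω => if hitCount A (fun j => Y j ω) k < M then 1 else 0 with he
  have hem : ∀ k, Measurable (e k) := fun k => measurable_hitCount_lt hA M k fun j _ => hY j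
  have he0 : ∀ k, 0 ≤ ∫ ω, e k ω ∂P := fun k => integral_nonneg fun ω => by
    simp only [he, Pi.zero_apply]; split_ifs <;> norm_num
  have hB0 : 0 ≤ B := (integral_nonneg fun ω => hφ0 _).trans (hB 0)
  have hmul : ∀ ψ : ℝ → ℝ, Measurable ψ → ∀ k,
      ∫ ω, ψ (Y k ω) * e k ω ∂P = (∫ ω, ψ (Y k ω) ∂P) * ∫ ω, e k ω ∂P := fun ψ hψ k =>
    ((indepFun_hitCount_lt hind hY hA M k).comp hψ measurable_id).integral_fun_mul_eq_mul_integral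
      (hψ.comp (hY k)).aestronglyMeasurable (hem k).aestronglyMeasurable
  have hAm : Measurable fun y : ℝ => (if y ∈ A then 1 else 0 : ℝ) :=
    Measurable.ite hA measurable_const measurable_const
  have hAint : ∀ k, ∫ ω, (if Y k ω ∈ A then 1 else 0 : ℝ) ∂P = P.real {ω | Y k ω ∈ A} := fun k => by
    rw [← integral_indicator_one (show MeasurableSet {ω | Y k ω ∈ A} from hY k hA)]
    refine integral_congr_ae (.of_forall fun ω => ?_)
    simp [Set.indicator_apply]
  -- At most `M` hits are ever counted and each running sample hits with probability at least `p`,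
  -- so the expected number of samples is at most `M / p`.
  have hcount : p * ∑ k ∈ range n, ∫ ω, e k ω ∂P ≤ M := by
    calc p * ∑ k ∈ range n, ∫ ω, e k ω ∂P
        ≤ ∑ k ∈ range n, ∫ ω, (if Y k ω ∈ A then 1 else 0 : ℝ) * e k ω ∂P := by
          rw [Finset.mul_sum]
          refine Finset.sum_le_sum fun k _ => ?_
          rw [hmul (fun y => if y ∈ A then 1 else 0) hAm k, hAint]
          exact mul_le_mul_of_nonneg_right (hpA k) (he0 k)
      _ = ∫ ω, ∑ k ∈ range n, (if Y k ω ∈ A then 1 else 0 : ℝ) * e k ω ∂P :=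
          (integral_finsetSum _ fun k _ => integrable_mul_hitCount_lt
            (φ := fun y => if y ∈ A then 1 else 0) (c := 1) hY hA hAm
            (fun y => by split_ifs <;> norm_num) (fun y => by split_ifs <;> norm_num) M k).symm
      _ ≤ ∫ _, (M : ℝ) ∂P := by
          refine integral_mono_of_nonneg (.of_forall fun ω => ?_) (integrable_const _)
            (.of_forall fun ω => sum_hits_le A (fun j => Y j ω) M n)
          refine Finset.sum_nonneg fun k _ => mul_nonneg ?_ ?_
          · split_ifs <;> norm_num
          · simp only [he]; split_ifs <;> norm_num
      _ = M := by simp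
  rw [integral_finsetSum _ fun k _ => integrable_mul_hitCount_lt hY hA hφ hφ0 hφc M k,
    le_div_iff₀ hp]
  calc (∑ k ∈ range n, ∫ ω, φ (Y k ω) * e k ω ∂P) * p
      ≤ (∑ k ∈ range n, B * ∫ ω, e k ω ∂P) * p := by
        refine mul_le_mul_of_nonneg_right (Finset.sum_le_sum fun k _ => ?_) hp.le
        rw [hmul φ hφ k]
        exact mul_le_mul_of_nonneg_right (hB k) (he0 k)
    _ = B * (p * ∑ k ∈ range n, ∫ ω, e k ω ∂P) := by rw [← Finset.mul_sum]; ring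
    _ ≤ M * B := by rw [mul_comm (M : ℝ)]; exact mul_le_mul_of_nonneg_left hcount hB0

/-- The expectation of `1 / max Y δ` for a variable with `ℙ(Y < x) = O(x ^ β)`. -/
theorem integral_one_div_max_le {Z : Ω → ℝ} (hZ : Measurable Z) (hZ1 : ∀ᵐ ω ∂P, Z ω ≤ 1)
    {β hi δ : ℝ} (hβ : 0 < β) (hhi : 0 < hi) (hδ : 0 < δ) (hδ1 : δ ≤ 1)
    (hup : ∀ x ∈ Set.Icc (0 : ℝ) 1, P.real {ω | Z ω < x} ≤ hi * x ^ β) :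
    ∫ ω, 1 / max (Z ω) δ ∂P ≤ δ ^ (β - max β 1) *
      (Real.exp β * (1 + Real.log (1 / δ) * (hi * Real.exp β))) := by
  have hlog : 0 ≤ Real.log (1 / δ) := Real.log_nonneg (by rw [le_div_iff₀ hδ]; linarith)
  set N := ⌊Real.log (1 / δ)⌋₊ with hN
  -- Layers at scale `e`: each summand has mean at most `hi * e ^ β`, and there are at most `log (1
  -- / δ)` of them. The leading `1` covers layer `0`, where the tail bound would need an argument
  -- above `1`.
  set F : Ω → ℝ := fun ω => δ ^ (β - max β 1) * (Real.exp β * (1 + ∑ i ∈ Icc 1 N,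
    Real.exp (β * i) * ({ω | Z ω < Real.exp (1 - i)}.indicator 1 ω))) with hF
  have hms : ∀ x : ℝ, MeasurableSet {ω | Z ω < x} := fun x => measurableSet_lt hZ measurable_const
  have hind : ∀ i : ℕ, Integrable (fun ω => Real.exp (β * i) *
      ({ω | Z ω < Real.exp (1 - (i : ℝ))}.indicator (1 : Ω → ℝ) ω)) P := fun i =>
    ((integrable_const (1 : ℝ)).indicator (hms _)).const_mul _
  have hFint : Integrable F P :=
    (((integrable_const (1 : ℝ)).add (integrable_finsetSum _ fun i _ => hind i)).const_mul
      _).const_mul _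
  have hpt : ∀ᵐ ω ∂P, 1 / max (Z ω) δ ≤ F ω := by
    filter_upwards [hZ1] with ω hω
    set y := max (Z ω) δ with hy
    have hy0 : 0 < y := lt_max_of_lt_right hδ
    have hyδ : δ ≤ y := le_max_right _ _
    have hy1 : y ≤ 1 := max_le hω hδ1
    -- On `[δ, 1]` the factor `y ^ (β - 1)` is at most `1` if `β ≥ 1` and at most `δ ^ (β - 1)`
    -- otherwise; this is where `max β 1` enters.
    have hstep : 1 / y ≤ δ ^ (β - max β 1) * y ^ (-β) := by
      have h1 : 1 / y = y ^ (β - 1) * y ^ (-β) := by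
        rw [← Real.rpow_add hy0, show β - 1 + -β = -1 by ring, Real.rpow_neg_one, one_div]
      rw [h1]
      refine mul_le_mul_of_nonneg_right ?_ (by positivity)
      rcases le_total β 1 with hb | hb
      · rw [max_eq_right hb]
        exact Real.rpow_le_rpow_of_nonpos hδ hyδ (by linarith)
      · rw [max_eq_left hb, sub_self, Real.rpow_zero]
        exact Real.rpow_le_one hy0.le hy1 (by linarith)
    refine hstep.trans (mul_le_mul_of_nonneg_left ?_ (by positivity))
    set l := Real.log (1 / y) with hl
    have hl0 : 0 ≤ l := Real.log_nonneg (by rw [le_div_iff₀ hy0]; linarith)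
    have hle : l ≤ Real.log (1 / δ) :=
      Real.log_le_log (by positivity) (one_div_le_one_div_of_le hδ hyδ)
    have hly : y = Real.exp (-l) := by
      rw [hl, one_div, Real.log_inv, neg_neg, Real.exp_log hy0]
    set i := ⌊l⌋₊ with hi'
    have hi1 : (i : ℝ) ≤ l := Nat.floor_le hl0
    have hi2 : l < i + 1 := Nat.lt_floor_add_one l
    have hpow : y ^ (-β) ≤ Real.exp β * Real.exp (β * i) := by
      rw [hly, ← Real.exp_mul, ← Real.exp_add]
      exact Real.exp_le_exp.2 (by nlinarith)
    refine hpow.trans (mul_le_mul_of_nonneg_left ?_ (Real.exp_pos _).le)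
    have hnn : ∀ j ∈ Icc 1 N, 0 ≤ Real.exp (β * j) *
        ({ω | Z ω < Real.exp (1 - (j : ℝ))}.indicator (1 : Ω → ℝ) ω) := fun j _ =>
      mul_nonneg (Real.exp_pos _).le (Set.indicator_nonneg (fun _ _ => zero_le_one) _)
    rcases Nat.eq_zero_or_pos i with h0 | h0
    · rw [h0]
      simpa using Finset.sum_nonneg hnn
    · have hmem : i ∈ Icc 1 N := Finset.mem_Icc.2 ⟨h0, Nat.floor_le_floor hle⟩
      -- The spare factor `e` in the level turns `y ≤ e ^ (-i)` into the strict inequality that the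
      -- tail bound requires.
      have hlt : Z ω < Real.exp (1 - (i : ℝ)) := by
        refine (le_max_left _ _).trans_lt ((hly.trans_lt ?_ : y < _))
        exact Real.exp_lt_exp.2 (by linarith)
      have := Finset.single_le_sum hnn hmem
      have hlt' : ω ∈ {ω | Z ω < Real.exp (1 - (i : ℝ))} := hlt
      rw [Set.indicator_of_mem hlt', Pi.one_apply, mul_one] at this
      linarith
  have hFle : ∫ ω, F ω ∂P ≤ δ ^ (β - max β 1) *
      (Real.exp β * (1 + Real.log (1 / δ) * (hi * Real.exp β))) := by
    rw [hF, integral_const_mul, integral_const_mul, integral_add (integrable_const _)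
      (integrable_finsetSum _ fun i _ => hind i), integral_finsetSum _ fun i _ => hind i]
    refine mul_le_mul_of_nonneg_left (mul_le_mul_of_nonneg_left ?_ (Real.exp_pos _).le)
      (by positivity)
    refine add_le_add (by simp) ?_
    have hterm : ∀ i ∈ Icc 1 N, ∫ ω, Real.exp (β * i) *
        ({ω | Z ω < Real.exp (1 - (i : ℝ))}.indicator (1 : Ω → ℝ) ω) ∂P ≤ hi * Real.exp β := by
      intro i hi'
      have h1 : (1 : ℝ) ≤ i := by exact_mod_cast (Finset.mem_Icc.1 hi').1
      rw [integral_const_mul, integral_indicator_one (hms _)]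
      have := hup (Real.exp (1 - i)) ⟨(Real.exp_pos _).le, Real.exp_le_one_iff.2 (by linarith)⟩
      refine (mul_le_mul_of_nonneg_left this (Real.exp_pos _).le).trans (le_of_eq ?_)
      rw [← Real.exp_mul, mul_left_comm, ← Real.exp_add]
      congr 2; ring
    refine (Finset.sum_le_card_nsmul _ _ _ hterm).trans ?_
    rw [Nat.card_Icc, Nat.add_sub_cancel, nsmul_eq_mul]
    exact mul_le_mul_of_nonneg_right (Nat.floor_le hlog) (by positivity)
  refine (integral_mono_of_nonneg (.of_forall fun ω => ?_) hFint hpt).trans hFle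
  have : 0 < max (Z ω) δ := lt_max_of_lt_right hδ
  simp only [Pi.zero_apply]; positivity

end Sampling

/-! ### The expected regret for a given threshold -/

section ExpectedRegret

variable [mΩ : MeasurableSpace Ω] {P : Measure Ω} [IsProbabilityMeasure P] {ℱ : Filtration ℕ mΩ}
  {μ₁ : 𝒜 → Ω → ℝ} {η ρ : ℕ → Ω → ℝ} {sel : ℕ → 𝒜} {β lo hi V δ : ℝ} {T S : ℕ}

theorem gapAt_mem_Icc {m : 𝒜 → ℝ} {η ρ : ℕ → ℝ} (hsel : Function.Injective sel)
    (hρ : ∀ t, 0 ≤ ρ t) (hm : ∀ k, m (sel k) ∈ Set.Icc (0 : ℝ) 1)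
    (hV : ∑ t ∈ Ico 1 T, ρ t ≤ V) {t : ℕ} (ht : t ∈ Icc 1 T) :
    gapAt T δ sel m η ρ t ∈ Set.Icc 0 (1 + V) := by
  rw [Finset.mem_Icc] at ht
  rw [gapAt_eq hsel ht.1]
  set k := idxAt T δ sel m η ρ t
  have h1 := hm k
  have h2 : 0 ≤ ∑ u ∈ (Ico 1 t).filter (fun u => idxAt T δ sel m η ρ u = k), ρ u :=
    Finset.sum_nonneg fun u _ => hρ u
  have h3 : ∑ u ∈ (Ico 1 t).filter (fun u => idxAt T δ sel m η ρ u = k), ρ u ≤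
      ∑ t ∈ Ico 1 T, ρ t :=
    Finset.sum_le_sum_of_subset_of_nonneg ((Finset.filter_subset _ _).trans
      (Finset.Ico_subset_Ico le_rfl ht.2)) fun u _ _ => hρ u
  exact ⟨by linarith [h1.2], by linarith [h1.1]⟩

theorem regret_mem_Icc {m : 𝒜 → ℝ} {η ρ : ℕ → ℝ} (hsel : Function.Injective sel)
    (hρ : ∀ t, 0 ≤ ρ t) (hm : ∀ k, m (sel k) ∈ Set.Icc (0 : ℝ) 1)
    (hV : ∑ t ∈ Ico 1 T, ρ t ≤ V) :
    regret T δ sel m η ρ ∈ Set.Icc 0 (T * (1 + V)) := by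
  rw [regret_eq_sum_gapAt]
  refine ⟨Finset.sum_nonneg fun t ht => (gapAt_mem_Icc hsel hρ hm hV ht).1, ?_⟩
  have := Finset.sum_le_card_nsmul _ _ _ fun t ht =>
    (gapAt_mem_Icc (δ := δ) (η := η) hsel hρ hm hV ht).2
  simpa [mul_add] using this

/-- The random number of arms used is traded for an indicator that depends on the initial means
alone, which makes the right-hand side accessible to the Wald-type bound whatever the adversary
does. -/
theorem regret_le_of_goodNoise {m : 𝒜 → ℝ} {η ρ : ℕ → ℝ} (hsel : Function.Injective sel)
    (hρ : ∀ t, 0 ≤ ρ t) (hm : ∀ k, m (sel k) ∈ Set.Icc (0 : ℝ) 1) (hT : 1 ≤ T)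
    (hδ : 0 < δ) (hδ1 : δ ≤ 1) (hV : ∑ t ∈ Ico 1 T, ρ t ≤ V)
    (hS : 1 + ((Ico 1 T).filter fun t => ρ t ≠ 0).card ≤ S) {M : ℕ}
    (hM : 2 * V / δ < M ∨ S ≤ M) (hη : GoodNoise T η) :
    regret T δ sel m η ρ ≤ 2 * δ * T + (1536 * Real.log T + 1) *
      (∑ k ∈ range T, 1 / max (1 - m (sel k)) δ *
        if hitCount (Set.Iio (δ / 2)) (fun j => 1 - m (sel j)) k < M then 1 else 0) + V := by
  have hpath := thresholdPath_run (δ := δ) (m := m) hsel hρ hη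
  have hL : 0 ≤ Real.log T := Real.log_natCast_nonneg T
  have hbound := hpath.sum_gap_le hρ (by positivity) hδ hδ1 fun k => by linarith [(hm k).1]
  have hcount : hitCount (Set.Iio (δ / 2)) (fun j => 1 - m (sel j)) (idxAt T δ sel m η ρ T) < M := by
    have : hitCount (Set.Iio (δ / 2)) (fun j => 1 - m (sel j)) (idxAt T δ sel m η ρ T) =
        ((range (idxAt T δ sel m η ρ T)).filter fun k => 1 - m (sel k) < δ / 2).card := by
      simp only [hitCount, Set.mem_Iio]
    rw [this]
    rcases hM with hM | hM
    · exact hpath.card_replaced_lt_of_slow hρ hδ hT hV hM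
    · have := hpath.card_replaced_le_of_abrupt hρ hδ hT
      omega
  have hκ : 32 * (2 * √(12 * Real.log T)) ^ 2 + 1 = 1536 * Real.log T + 1 := by
    rw [mul_pow, Real.sq_sqrt (by positivity)]; ring
  rw [hκ, ← regret_eq_sum_gapAt] at hbound
  have hsum : ∑ k ∈ range (idxAt T δ sel m η ρ T + 1), 1 / max (1 - m (sel k)) δ ≤
      ∑ k ∈ range T, 1 / max (1 - m (sel k)) δ *
        if hitCount (Set.Iio (δ / 2)) (fun j => 1 - m (sel j)) k < M then 1 else 0 := by
    have hpos : ∀ k, 0 ≤ 1 / max (1 - m (sel k)) δ := fun k => by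
      have : 0 < max (1 - m (sel k)) δ := lt_max_of_lt_right hδ
      positivity
    calc _ = ∑ k ∈ range (idxAt T δ sel m η ρ T + 1), 1 / max (1 - m (sel k)) δ *
        (if hitCount (Set.Iio (δ / 2)) (fun j => 1 - m (sel j)) k < M then 1 else 0) := by
          -- `hitCount` is monotone in `k` and still below `M` at the last arm used, so every
          -- indicator up to there equals `1`.
          refine Finset.sum_congr rfl fun k hk => ?_
          rw [if_pos, mul_one]
          refine lt_of_le_of_lt (Finset.card_le_card (Finset.filter_subset_filter _ ?_)) hcount
          exact Finset.range_subset_range.2 (Nat.lt_succ_iff.1 (Finset.mem_range.1 hk))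
      _ ≤ _ := by
          refine Finset.sum_le_sum_of_subset_of_nonneg
            (Finset.range_subset_range.2 (hpath.lt hT)) fun k _ _ => mul_nonneg (hpos k) ?_
          split_ifs <;> norm_num
  have := mul_le_mul_of_nonneg_left hsum (by positivity : 0 ≤ 1536 * Real.log T + 1)
  linarith

theorem integrable_regret_and_integral_le (hβ : 0 < β) (hlo : 0 < lo) (hhi : 0 < hi)
    (hT : 1 ≤ T) (hV0 : 0 ≤ V) (hVT : V ≤ T) (hδ : 0 < δ) (hδ1 : δ ≤ 1)
    (hμ : InitialMeans P β lo hi μ₁) (hη : SubGaussianNoise P ℱ η)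
    (hρ : AdaptiveAdversary P ℱ T V S ρ) (hsel : Function.Injective sel) {M : ℕ}
    (hM : 2 * V / δ < M ∨ S ≤ M) :
    Integrable (fun ω => regret T δ sel (fun a => μ₁ a ω) (fun t => η t ω) (fun t => ρ t ω)) P ∧
      ∫ ω, regret T δ sel (fun a => μ₁ a ω) (fun t => η t ω) (fun t => ρ t ω) ∂P ≤
        2 * δ * T + (1536 * Real.log T + 1) * (M * (δ ^ (β - max β 1) *
          (Real.exp β * (1 + Real.log (1 / δ) * (hi * Real.exp β)))) / (lo * (δ / 2) ^ β)) +
          V + 4 := by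
  have hρ0 : ∀ᵐ ω ∂P, ∀ t, 0 ≤ ρ t ω := ae_all_iff.2 hρ.nonneg
  have hm : ∀ᵐ ω ∂P, ∀ k, μ₁ (sel k) ω ∈ Set.Icc (0 : ℝ) 1 :=
    ae_all_iff.2 fun k => hμ.mem_Icc (sel k)
  have hρm : ∀ t, Measurable (ρ t) := fun t => (hρ.adapted t).mono (ℱ.le t) le_rfl
  have hT0 : (1 : ℝ) ≤ T := by exact_mod_cast hT
  have hL : 0 ≤ Real.log T := Real.log_natCast_nonneg T
  set R : Ω → ℝ := fun ω =>
    regret T δ sel (fun a => μ₁ a ω) (fun t => η t ω) (fun t => ρ t ω) with hR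
  have hRm : Measurable R := measurable_regret T δ sel hμ.measurable hη.measurable hρm
  have hRmem : ∀ᵐ ω ∂P, R ω ∈ Set.Icc 0 (T * (1 + V)) := by
    filter_upwards [hρ0, hm, hρ.slow] with ω h1 h2 h3
    exact regret_mem_Icc hsel h1 h2 h3
  have hRint : Integrable R P := by
    refine Integrable.of_bound hRm.aestronglyMeasurable (T * (1 + V)) ?_
    filter_upwards [hRmem] with ω h
    rw [Real.norm_eq_abs, abs_of_nonneg h.1]; exact h.2
  refine ⟨hRint, ?_⟩
  set Y : ℕ → Ω → ℝ := fun k ω => 1 - μ₁ (sel k) ω with hY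
  have hYm : ∀ k, Measurable (Y k) := fun k => measurable_const.sub (hμ.measurable _)
  have hYind : iIndepFun Y P :=
    (hμ.indep.precomp hsel).comp (fun _ x => 1 - x) fun _ => measurable_const.sub measurable_id
  set φ : ℝ → ℝ := fun y => 1 / max y δ with hφ
  have hφm : Measurable φ := measurable_const.div (measurable_id.max measurable_const)
  have hφ0 : ∀ y, 0 ≤ φ y := fun y => by
    have : 0 < max y δ := lt_max_of_lt_right hδ
    simp only [hφ]; positivity
  have hφc : ∀ y, φ y ≤ 1 / δ := fun y => one_div_le_one_div_of_le hδ (le_max_right _ _)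
  set Q : Ω → ℝ := fun ω => ∑ k ∈ range T, φ (Y k ω) *
    (if hitCount (Set.Iio (δ / 2)) (fun j => Y j ω) k < M then 1 else 0) with hQ
  have hQint : Integrable Q P := integrable_finsetSum _ fun k _ =>
    integrable_mul_hitCount_lt hYm measurableSet_Iio hφm hφ0 hφc M k
  have hQ0 : ∀ ω, 0 ≤ Q ω := fun ω => Finset.sum_nonneg fun k _ => mul_nonneg (hφ0 _) (by
    split_ifs <;> norm_num)
  have hset : ∀ k x, {ω | Y k ω < x} = {ω | 1 - x < μ₁ (sel k) ω} := fun k x => by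
    ext ω; simp only [hY, Set.mem_ofPred_eq]; constructor <;> intro h <;> linarith
  have hQle : ∫ ω, Q ω ∂P ≤ M * (δ ^ (β - max β 1) *
      (Real.exp β * (1 + Real.log (1 / δ) * (hi * Real.exp β)))) / (lo * (δ / 2) ^ β) := by
    refine integral_sum_until_hits_le hYind hYm measurableSet_Iio hφm hφ0 hφc (by positivity)
      (fun k => ?_) (fun k => ?_) M T
    · simp only [Set.mem_Iio, hset]
      exact hμ.lower (sel k) (δ / 2) ⟨by positivity, by linarith⟩
    · refine integral_one_div_max_le (hYm k) ?_ hβ hhi hδ hδ1 fun x hx => ?_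
      · filter_upwards [hm] with ω h
        simp only [hY]; linarith [(h k).1]
      · rw [hset]; exact hμ.upper (sel k) x hx
  set bad : Set Ω := {ω | ¬ GoodNoise T fun t => η t ω} with hbad
  have hbadm : MeasurableSet bad := (hη.measurableSet_goodNoise T).compl
  -- On the bad noise event only the trivial bound `T * (1 + V)` is available.
  set F : Ω → ℝ := fun ω => (2 * δ * T + (1536 * Real.log T + 1) * Q ω + V) +
    bad.indicator (fun _ => T * (1 + V)) ω with hF
  have hi1 : Integrable (fun ω => (1536 * Real.log T + 1) * Q ω) P := hQint.const_mul _
  have hi2 : Integrable (fun ω => 2 * δ * T + (1536 * Real.log T + 1) * Q ω) P :=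
    (integrable_const _).add hi1
  have hi3 : Integrable (fun ω => 2 * δ * T + (1536 * Real.log T + 1) * Q ω + V) P :=
    hi2.add (integrable_const _)
  have hi4 : Integrable (bad.indicator fun _ => (T : ℝ) * (1 + V)) P :=
    (integrable_const _).indicator hbadm
  have hRF : ∀ᵐ ω ∂P, R ω ≤ F ω := by
    filter_upwards [hρ0, hm, hρ.slow, hρ.abrupt, hRmem] with ω h1 h2 h3 h4 h5
    by_cases hg : GoodNoise T fun t => η t ω
    · have := regret_le_of_goodNoise (m := fun a => μ₁ a ω) hsel h1 h2 hT hδ hδ1 h3 h4 hM hg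
      simp only [hF]
      rw [Set.indicator_of_notMem (by simpa [hbad] using hg), add_zero]
      exact this
    · simp only [hF]
      rw [Set.indicator_of_mem (by simpa [hbad] using hg)]
      have := mul_nonneg (by positivity : 0 ≤ 1536 * Real.log T + 1) (hQ0 ω)
      have : 0 ≤ 2 * δ * T := by positivity
      linarith [h5.2]
  have hbadle : P.real bad * (T * (1 + V)) ≤ 4 := by
    have h1 := hη.measureReal_not_goodNoise_le hT
    have h2 : (T : ℝ) * (1 + V) ≤ 2 * T ^ 2 := by nlinarith
    calc P.real bad * (T * (1 + V)) ≤ 2 / (T : ℝ) ^ 4 * (2 * T ^ 2) :=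
          mul_le_mul h1 h2 (by positivity) (by positivity)
      _ = 4 / (T : ℝ) ^ 2 := by field_simp; norm_num
      _ ≤ 4 := div_le_self (by norm_num) (one_le_pow₀ hT0)
  calc ∫ ω, R ω ∂P ≤ ∫ ω, F ω ∂P := integral_mono_ae hRint (hi3.add hi4) hRF
    _ = 2 * δ * T + (1536 * Real.log T + 1) * ∫ ω, Q ω ∂P + V + P.real bad * (T * (1 + V)) := by
        rw [hF, integral_add hi3 hi4, integral_add hi2 (integrable_const _),
          integral_add (integrable_const _) hi1, integral_const_mul (1536 * Real.log T + 1) Q,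
          integral_indicator_const _ hbadm]
        simp
    _ ≤ _ := by
        have := mul_le_mul_of_nonneg_left hQle (by positivity : 0 ≤ 1536 * Real.log T + 1)
        linarith

end ExpectedRegret

/-! ### Tuning of the threshold -/

/-- The constant in front of `δ T + M δ^{-max β 1} + V`. -/
def regretConst (β c₁ lo hi : ℝ) : ℝ :=
  3 + 4 / c₁ +
    1536 * (2 ^ β / lo * (Real.exp β * (1 + (1 + Real.log (1 / c₁)) * (hi * Real.exp β))))

theorem log_one_div_nonneg {c : ℝ} (hc : 0 < c) (hc' : c ≤ 1) : 0 ≤ Real.log (1 / c) :=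
  Real.log_nonneg (by rw [le_div_iff₀ hc]; linarith)

theorem regretConst_pos {β c₁ lo hi : ℝ} (hc₁ : 0 < c₁) (hc₁' : c₁ < 1) (hlo : 0 < lo)
    (hhi : 0 < hi) : 0 < regretConst β c₁ lo hi := by
  have := log_one_div_nonneg hc₁ hc₁'.le
  unfold regretConst
  positivity

/-- The lower bound `c₁ / T ≤ δ` serves twice: it gives `log (1 / δ) ≤ log (1 / c₁) + log T`, and it
absorbs the additive `4` into `(4 / c₁) * (δ * T)`. -/
theorem regret_bound_le {β c₁ lo hi V δ : ℝ} {T M : ℕ} (hc₁ : 0 < c₁) (hc₁' : c₁ < 1)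
    (hlo : 0 < lo) (hhi : 0 < hi) (hT : 1 ≤ T) (hV0 : 0 ≤ V) (hδ1 : δ ≤ 1)
    (hδT : c₁ / T ≤ δ) :
    2 * δ * T + (1536 * Real.log T + 1) * (M * (δ ^ (β - max β 1) *
          (Real.exp β * (1 + Real.log (1 / δ) * (hi * Real.exp β)))) / (lo * (δ / 2) ^ β)) +
          V + 4 ≤
      regretConst β c₁ lo hi * (1 + Real.log T) ^ 2 * (δ * T + M * δ ^ (-max β 1) + V) := by
  have hT0 : (0 : ℝ) < T := by exact_mod_cast hT
  have hδ : 0 < δ := lt_of_lt_of_le (by positivity) hδT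
  have hL : 0 ≤ Real.log T := Real.log_natCast_nonneg T
  have hl := log_one_div_nonneg hc₁ hc₁'.le
  have hlogδ : Real.log (1 / δ) ≤ Real.log (1 / c₁) + Real.log T := by
    rw [← Real.log_mul (by positivity) (by positivity)]
    refine Real.log_le_log (by positivity) ?_
    rw [one_div_mul_eq_div, ← one_div_div c₁]
    exact one_div_le_one_div_of_le (by positivity) hδT
  have hpow : δ ^ (β - max β 1) / (lo * (δ / 2) ^ β) = 2 ^ β / lo * δ ^ (-max β 1) := by
    rw [Real.div_rpow hδ.le (by norm_num), sub_eq_add_neg, Real.rpow_add hδ]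
    have := Real.rpow_pos_of_pos hδ β
    have : (0 : ℝ) < 2 ^ β := by positivity
    field_simp
  set L := Real.log T
  set ℓ := Real.log (1 / c₁)
  set E := Real.exp β
  have hE : 0 < E := Real.exp_pos β
  set D := δ ^ (-max β 1) with hD
  have hD0 : 0 < D := by positivity
  set K := 2 ^ β / lo with hK
  have hK0 : 0 < K := by positivity
  have hfac : E * (1 + Real.log (1 / δ) * (hi * E)) ≤ E * (1 + (1 + ℓ) * (hi * E)) * (1 + L) := by
    rw [mul_assoc]
    refine mul_le_mul_of_nonneg_left ?_ hE.le
    have h1 : Real.log (1 / δ) * (hi * E) ≤ (ℓ + L) * (hi * E) :=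
      mul_le_mul_of_nonneg_right hlogδ (by positivity)
    have h2 : (ℓ + L) * (hi * E) ≤ (1 + ℓ) * (1 + L) * (hi * E) :=
      mul_le_mul_of_nonneg_right (by nlinarith [mul_nonneg hl hL]) (by positivity)
    linarith
  set G := E * (1 + (1 + ℓ) * (hi * E)) with hG
  have hG0 : 0 < G := by positivity
  have hmid : (M : ℝ) * (δ ^ (β - max β 1) * (E * (1 + Real.log (1 / δ) * (hi * E)))) /
      (lo * (δ / 2) ^ β) ≤ K * G * (1 + L) * (M * D) := by
    calc _ = (M : ℝ) * (δ ^ (β - max β 1) / (lo * (δ / 2) ^ β)) *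
          (E * (1 + Real.log (1 / δ) * (hi * E))) := by ring
      _ ≤ (M : ℝ) * (K * D) * (G * (1 + L)) := by
          rw [hpow]
          exact mul_le_mul_of_nonneg_left hfac (by positivity)
      _ = _ := by ring
  have hmid2 : (1536 * L + 1) * ((M : ℝ) * (δ ^ (β - max β 1) *
      (E * (1 + Real.log (1 / δ) * (hi * E)))) / (lo * (δ / 2) ^ β)) ≤
      1536 * (K * G) * (1 + L) ^ 2 * (M * D) := by
    calc _ ≤ (1536 * (1 + L)) * (K * G * (1 + L) * (M * D)) :=
          mul_le_mul (by linarith) hmid (by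
            have := log_one_div_nonneg hδ hδ1
            positivity) (by positivity)
      _ = _ := by ring
  have hone : 1 ≤ (1 + L) ^ 2 := one_le_pow₀ (by linarith)
  have h4 : 4 ≤ 4 / c₁ * (δ * T) := by
    rw [div_mul_eq_mul_div, le_div_iff₀ hc₁]
    rw [div_le_iff₀ hT0] at hδT
    linarith
  have hA : 2 * δ * T + V + 4 ≤ (3 + 4 / c₁) * (1 + L) ^ 2 * (δ * T + M * D + V) := by
    have hx : 0 ≤ δ * T := by positivity
    have hy : 0 ≤ M * D := by positivity
    have hc : 0 < 4 / c₁ := by positivity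
    calc 2 * δ * T + V + 4 ≤ (3 + 4 / c₁) * 1 * (δ * T + M * D + V) := by
          nlinarith [mul_nonneg hc.le hy, mul_nonneg hc.le hV0]
      _ ≤ _ := by gcongr
  have hB : 1536 * (K * G) * (1 + L) ^ 2 * (M * D) ≤
      1536 * (K * G) * (1 + L) ^ 2 * (δ * T + M * D + V) := by
    refine mul_le_mul_of_nonneg_left ?_ (by positivity)
    have : 0 ≤ δ * T := by positivity
    linarith
  have hconst : regretConst β c₁ lo hi = 3 + 4 / c₁ + 1536 * (K * G) := rfl
  rw [hconst, add_mul, add_mul]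
  linarith

/-- The common scale of `δ_V` and `R_V`. -/
def scaleV (β V : ℝ) (T : ℕ) : ℝ :=
  max ((V / T) ^ (1 / (max β 1 + 2))) ((T : ℝ) ^ (-(1 / (max β 1 + 1))))

/-- The common scale of `δ_S` and `R_S`. -/
def scaleS (β : ℝ) (S T : ℕ) : ℝ := ((S : ℝ) / T) ^ (1 / (max β 1 + 1))

/-- Replacing `β` by `max β 1` merges the two regimes: the exponents `1/3` and `1/2` are the values
of `1/(γ + 2)` and `1/(γ + 1)` at `γ = 1`. -/
theorem deltaV_eq (c₁ β V : ℝ) (T : ℕ) : deltaV c₁ β V T = c₁ * scaleV β V T := by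
  unfold deltaV scaleV
  split_ifs with h
  · rw [max_eq_left h, Real.rpow_neg (Nat.cast_nonneg T), one_div ((T : ℝ) ^ _)]
  · rw [max_eq_right (not_le.1 h).le, Real.rpow_neg (Nat.cast_nonneg T), Real.sqrt_eq_rpow]
    norm_num

theorem deltaS_eq (c₁ β : ℝ) (S T : ℕ) : deltaS c₁ β S T = c₁ * scaleS β S T := by
  unfold deltaS scaleS
  split_ifs with h
  · rw [max_eq_left h]
  · rw [max_eq_right (not_le.1 h).le]; norm_num

theorem mul_div_rpow {x T a : ℝ} (hx : 0 ≤ x) (hT : 0 < T) :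
    T * (x / T) ^ a = x ^ a * T ^ (1 - a) := by
  rw [Real.div_rpow hx hT.le, Real.rpow_sub hT, Real.rpow_one]
  ring

theorem rateV_eq {β V : ℝ} {T : ℕ} (hT : 1 ≤ T) (hβ : 0 < β) (hV : 0 ≤ V) :
    rateV β V T = T * scaleV β V T := by
  have hT0 : (0 : ℝ) < T := by exact_mod_cast hT
  have hneg : ∀ a : ℝ, (T : ℝ) * (T : ℝ) ^ (-a) = (T : ℝ) ^ (1 - a) := fun a => by
    rw [sub_eq_add_neg, Real.rpow_add hT0, Real.rpow_one]
  unfold rateV scaleV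
  rw [mul_max_of_nonneg _ _ hT0.le, mul_div_rpow hV hT0, hneg]
  split_ifs with h
  · rw [max_eq_left h]
    congr 3 <;> field_simp <;> ring
  · rw [max_eq_right (not_le.1 h).le, Real.sqrt_eq_rpow]
    norm_num

theorem rateS_eq {β V : ℝ} {S T : ℕ} (hT : 1 ≤ T) (hβ : 0 < β) :
    rateS β V S T = max (T * scaleS β S T) V := by
  have hT0 : (0 : ℝ) < T := by exact_mod_cast hT
  unfold rateS scaleS
  rw [mul_div_rpow (Nat.cast_nonneg S) hT0]
  split_ifs with h
  · rw [max_eq_left h]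
    congr 3; field_simp; ring
  · rw [max_eq_right (not_le.1 h).le, Real.sqrt_eq_rpow, Real.mul_rpow (by positivity) hT0.le]
    norm_num

theorem one_div_le_rpow_neg {T : ℝ} {a : ℝ} (hT : 1 ≤ T) (ha : a ≤ 1) :
    1 / T ≤ T ^ (-a) := by
  rw [one_div, ← Real.rpow_neg_one]
  exact Real.rpow_le_rpow_of_exponent_le hT (by linarith)

theorem one_div_add_one_le_one {γ : ℝ} (hγ : 1 ≤ γ) : 1 / (γ + 1) ≤ 1 := by
  rw [div_le_one (by linarith)]; linarith

theorem scaleV_le_one {β V : ℝ} {T : ℕ} (hT : 1 ≤ T) (hV : 0 ≤ V) (hVT : V ≤ T) :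
    scaleV β V T ≤ 1 := by
  have hT0 : (1 : ℝ) ≤ T := by exact_mod_cast hT
  have hγ : 1 ≤ max β 1 := le_max_right _ _
  refine max_le (Real.rpow_le_one (by positivity) ?_ (by positivity)) ?_
  · rw [div_le_one (by linarith)]; exact hVT
  · exact Real.rpow_le_one_of_one_le_of_nonpos hT0 (by rw [neg_nonpos]; positivity)

theorem one_div_le_scaleV {β V : ℝ} {T : ℕ} (hT : 1 ≤ T) : 1 / (T : ℝ) ≤ scaleV β V T :=
  (one_div_le_rpow_neg (by exact_mod_cast hT)
    (one_div_add_one_le_one (le_max_right β 1))).trans (le_max_right _ _)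

theorem scaleS_le_one {β : ℝ} {S T : ℕ} (hT : 1 ≤ T) (hST : S ≤ T) : scaleS β S T ≤ 1 := by
  have hT0 : (0 : ℝ) < T := by exact_mod_cast hT
  have hγ : 1 ≤ max β 1 := le_max_right _ _
  refine Real.rpow_le_one (by positivity) ?_ (by positivity)
  rw [div_le_one hT0]; exact_mod_cast hST

theorem one_div_le_scaleS {β : ℝ} {S T : ℕ} (hT : 1 ≤ T) (hS : 1 ≤ S) :
    1 / (T : ℝ) ≤ scaleS β S T := by
  have hT0 : (1 : ℝ) ≤ T := by exact_mod_cast hT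
  have hS0 : (1 : ℝ) ≤ S := by exact_mod_cast hS
  have hγ : 1 ≤ max β 1 := le_max_right _ _
  refine (one_div_le_rpow_neg hT0 (one_div_add_one_le_one hγ)).trans ?_
  rw [Real.rpow_neg (by positivity), ← Real.inv_rpow (by positivity), ← one_div]
  exact Real.rpow_le_rpow (by positivity) (div_le_div_of_nonneg_right hS0 (by positivity))
    (by positivity)

/-- Since `x ≤ x ^ a` for `x ∈ [0, 1]` and `0 < a ≤ 1`, the additive `V` is absorbed by `R_V`. The
same fact decides the comparison of `R_V` with `R_S`. -/
theorem le_mul_scaleV {β V : ℝ} {T : ℕ} (hT : 1 ≤ T) (hV : 0 ≤ V) (hVT : V ≤ T) :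
    V ≤ T * scaleV β V T := by
  have hT0 : (0 : ℝ) < T := by exact_mod_cast hT
  have hγ : 1 ≤ max β 1 := le_max_right _ _
  rw [← div_le_iff₀' hT0]
  refine le_trans ?_ (le_max_left _ _)
  refine Real.self_le_rpow_of_le_one (by positivity) ?_ ?_
  · rw [div_le_one hT0]; exact hVT
  · rw [div_le_one (by linarith)]; linarith

theorem le_rpow_of_rpow_one_div_le {x y a : ℝ} (hx : 0 ≤ x) (ha : 0 < a)
    (h : x ^ (1 / a) ≤ y) : x ≤ y ^ a := by
  have := Real.rpow_le_rpow (by positivity) h ha.le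
  rwa [← Real.rpow_mul hx, one_div_mul_cancel ha.ne', Real.rpow_one] at this

/-- The balancing inequality: the scale is chosen so that `A / T ≤ D ^ (a + 1)`, and then the
exploration cost `A * D ^ (-a)` is dominated by the threshold cost `T * D`. -/
theorem mul_rpow_neg_le {A T D a b : ℝ} (hT : 0 < T) (hD : 0 < D) (hab : b = a + 1)
    (h : A / T ≤ D ^ b) : A * D ^ (-a) ≤ T * D := by
  rw [div_le_iff₀ hT] at h
  calc A * D ^ (-a) ≤ D ^ b * T * D ^ (-a) := mul_le_mul_of_nonneg_right h (by positivity)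
    _ = T * (D ^ b * D ^ (-a)) := by ring
    _ = T * D := by rw [← Real.rpow_add hD, hab, show a + 1 + -a = 1 by ring, Real.rpow_one]

/-- With `M ≤ 2V/δ + 1`, the cost `M δ ^ (-γ)` splits into `V δ ^ (-(γ + 1))` and `δ ^ (-γ)`, up to
constants. The two entries of the maximum in `scaleV` balance these two terms against `T * D`. -/
theorem tuning_slow {β c₁ V : ℝ} {T : ℕ} (hc₁ : 0 < c₁) (hc₁' : c₁ < 1)
    (hT : 1 ≤ T) (hV : 0 ≤ V) (hVT : V ≤ T) :
    (c₁ * scaleV β V T) * T +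
        (⌊2 * V / (c₁ * scaleV β V T)⌋₊ + 1 : ℕ) * (c₁ * scaleV β V T) ^ (-max β 1) + V ≤
      (2 + 3 * c₁ ^ (-(max β 1 + 1))) * (T * scaleV β V T) := by
  have hT0 : (0 : ℝ) < T := by exact_mod_cast hT
  have hγ : 1 ≤ max β 1 := le_max_right _ _
  have hD : 0 < scaleV β V T := lt_of_lt_of_le (by positivity) (one_div_le_scaleV hT)
  have hVD := le_mul_scaleV (β := β) hT hV hVT
  have h1 : V / T ≤ scaleV β V T ^ (max β 1 + 2) :=
    le_rpow_of_rpow_one_div_le (by positivity) (by linarith) (le_max_left _ _)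
  have h2 : 1 / T ≤ scaleV β V T ^ (max β 1 + 1) := by
    refine le_rpow_of_rpow_one_div_le (by positivity) (by linarith)
      (le_trans (le_of_eq ?_) (le_max_right _ _))
    rw [one_div (T : ℝ), Real.inv_rpow hT0.le, Real.rpow_neg hT0.le]
  set D := scaleV β V T
  set γ := max β 1
  have h1' := mul_rpow_neg_le (a := γ + 1) hT0 hD (by ring) h1
  have h2' := mul_rpow_neg_le (a := γ) hT0 hD rfl h2
  have hfloor : ((⌊2 * V / (c₁ * D)⌋₊ + 1 : ℕ) : ℝ) ≤ 2 * V / (c₁ * D) + 1 := by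
    push_cast
    have := Nat.floor_le (by positivity : 0 ≤ 2 * V / (c₁ * D))
    linarith
  have hc : c₁ ^ (-γ) ≤ c₁ ^ (-(γ + 1)) :=
    Real.rpow_le_rpow_of_exponent_ge hc₁ hc₁'.le (by linarith)
  have hsplit : (2 * V / (c₁ * D) + 1) * (c₁ * D) ^ (-γ) =
      2 * c₁ ^ (-(γ + 1)) * (V * D ^ (-(γ + 1))) + c₁ ^ (-γ) * (1 * D ^ (-γ)) := by
    rw [Real.mul_rpow hc₁.le hD.le, neg_add, Real.rpow_add hc₁, Real.rpow_add hD,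
      Real.rpow_neg_one, Real.rpow_neg_one]
    field_simp
  have hmain : ((⌊2 * V / (c₁ * D)⌋₊ + 1 : ℕ) : ℝ) * (c₁ * D) ^ (-γ) ≤
      3 * c₁ ^ (-(γ + 1)) * (T * D) := by
    calc _ ≤ (2 * V / (c₁ * D) + 1) * (c₁ * D) ^ (-γ) :=
          mul_le_mul_of_nonneg_right hfloor (by positivity)
      _ ≤ 2 * c₁ ^ (-(γ + 1)) * (T * D) + c₁ ^ (-(γ + 1)) * (T * D) := by
          rw [hsplit]
          exact add_le_add (mul_le_mul_of_nonneg_left h1' (by positivity))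
            (mul_le_mul hc h2' (by positivity) (by positivity))
      _ = _ := by ring
  have : c₁ * D * T ≤ T * D := by nlinarith [mul_pos hD hT0]
  linarith

/-- One balancing suffices, as `M = S` does not depend on `δ`. The constant is larger than needed so
that both regimes share it. -/
theorem tuning_abrupt {β c₁ V : ℝ} {S T : ℕ} (hc₁ : 0 < c₁) (hc₁' : c₁ < 1)
    (hT : 1 ≤ T) (hS : 1 ≤ S) :
    (c₁ * scaleS β S T) * T + S * (c₁ * scaleS β S T) ^ (-max β 1) + V ≤
      (2 + 3 * c₁ ^ (-(max β 1 + 1))) * max (T * scaleS β S T) V := by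
  have hT0 : (0 : ℝ) < T := by exact_mod_cast hT
  have hγ : 1 ≤ max β 1 := le_max_right _ _
  have hD : 0 < scaleS β S T := lt_of_lt_of_le (by positivity) (one_div_le_scaleS hT hS)
  have h1 : S / T ≤ scaleS β S T ^ (max β 1 + 1) :=
    le_rpow_of_rpow_one_div_le (by positivity) (by linarith) le_rfl
  set D := scaleS β S T
  set γ := max β 1
  have h1' := mul_rpow_neg_le (a := γ) hT0 hD rfl h1
  have hc : c₁ ^ (-γ) ≤ c₁ ^ (-(γ + 1)) :=
    Real.rpow_le_rpow_of_exponent_ge hc₁ hc₁'.le (by linarith)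
  have hmain : (S : ℝ) * (c₁ * D) ^ (-γ) ≤ c₁ ^ (-(γ + 1)) * (T * D) := by
    calc _ = c₁ ^ (-γ) * (S * D ^ (-γ)) := by rw [Real.mul_rpow hc₁.le hD.le]; ring
      _ ≤ _ := mul_le_mul hc h1' (by positivity) (by positivity)
  have h2 : c₁ * D * T ≤ T * D := by nlinarith [mul_pos hD hT0]
  have hx : T * D ≤ max (T * D) V := le_max_left _ _
  have hy : V ≤ max (T * D) V := le_max_right _ _
  have hx0 : 0 < T * D := by positivity
  have hc0 : 0 < c₁ ^ (-(γ + 1)) := by positivity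
  nlinarith [mul_le_mul_of_nonneg_left hx hc0.le, mul_pos hc0 (hx0.trans_le hx)]

end

end RottingBandit

/-! ### Regret at the combined threshold -/

theorem corollary1 (β c₁ lo hi : ℝ) (hβ : 0 < β) (hc₁ : 0 < c₁) (hc₁' : c₁ < 1)
    (hlo : 0 < lo) (hhi : 0 < hi) :
    ∃ (C : ℝ) (k : ℕ), 0 < C ∧
      ∀ (T : ℕ) (V : ℝ) (S : ℕ), 1 ≤ T → 0 ≤ V → V ≤ T → 1 ≤ S → S ≤ T →
      ∀ (𝒜 : Type*) (Ω : Type*) (mΩ : MeasurableSpace Ω) (P : Measure Ω) [IsProbabilityMeasure P]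
        (ℱ : Filtration ℕ mΩ) (μ₁ : 𝒜 → Ω → ℝ) (η ρ : ℕ → Ω → ℝ) (sel : ℕ → 𝒜),
        RottingBandit.InitialMeans P β lo hi μ₁ →
        (∀ a, Measurable[ℱ 0] (μ₁ a)) →
        RottingBandit.SubGaussianNoise P ℱ η →
        RottingBandit.AdaptiveAdversary P ℱ T V S ρ →
        Function.Injective sel →
        Integrable (fun ω => RottingBandit.regret T
            (min (RottingBandit.deltaV c₁ β V T) (RottingBandit.deltaS c₁ β S T)) sel
            (fun a => μ₁ a ω) (fun t => η t ω) (fun t => ρ t ω)) P ∧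
          ∫ ω, RottingBandit.regret T
              (min (RottingBandit.deltaV c₁ β V T) (RottingBandit.deltaS c₁ β S T)) sel
              (fun a => μ₁ a ω) (fun t => η t ω) (fun t => ρ t ω) ∂P ≤
            C * (1 + Real.log T) ^ k *
              min (RottingBandit.rateV β V T) (RottingBandit.rateS β V S T) := by
  refine ⟨RottingBandit.regretConst β c₁ lo hi * (2 + 3 * c₁ ^ (-(max β 1 + 1))), 2,
    mul_pos (RottingBandit.regretConst_pos hc₁ hc₁' hlo hhi) (by positivity), ?_⟩
  intro T V S hT hV hVT hS hST 𝒜 Ω mΩ P _ ℱ μ₁ η ρ sel hμ _ hη hρ hsel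
  have hT0 : (0 : ℝ) < T := by exact_mod_cast hT
  have hC := RottingBandit.regretConst_pos (β := β) hc₁ hc₁' hlo hhi
  have hL : 0 ≤ Real.log T := Real.log_natCast_nonneg T
  have hVscale := RottingBandit.le_mul_scaleV (β := β) hT hV hVT
  rw [RottingBandit.deltaV_eq, RottingBandit.deltaS_eq, RottingBandit.rateV_eq hT hβ hV,
    RottingBandit.rateS_eq hT hβ]
  -- Both regimes in one statement: only the scale `D`, the cap `M` and the target rate `R` differ.
  have main : ∀ D : ℝ, 1 / (T : ℝ) ≤ D → D ≤ 1 → ∀ M : ℕ,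
      (2 * V / (c₁ * D) < M ∨ S ≤ M) → ∀ R : ℝ,
      (c₁ * D) * T + M * (c₁ * D) ^ (-max β 1) + V ≤ (2 + 3 * c₁ ^ (-(max β 1 + 1))) * R →
      Integrable (fun ω => RottingBandit.regret T (c₁ * D) sel
          (fun a => μ₁ a ω) (fun t => η t ω) (fun t => ρ t ω)) P ∧
        ∫ ω, RottingBandit.regret T (c₁ * D) sel
            (fun a => μ₁ a ω) (fun t => η t ω) (fun t => ρ t ω) ∂P ≤
          RottingBandit.regretConst β c₁ lo hi * (2 + 3 * c₁ ^ (-(max β 1 + 1))) *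
            (1 + Real.log T) ^ 2 * R := by
    intro D hD hD1 M hM R hR
    have hD0 : 0 < D := lt_of_lt_of_le (by positivity) hD
    have hδ1 : c₁ * D ≤ 1 := by nlinarith
    have hδT : c₁ / T ≤ c₁ * D := by
      rw [div_eq_mul_one_div]; exact mul_le_mul_of_nonneg_left hD hc₁.le
    obtain ⟨hint, hle⟩ := RottingBandit.integrable_regret_and_integral_le hβ hlo hhi hT hV hVT
      (mul_pos hc₁ hD0) hδ1 hμ hη hρ hsel hM
    refine ⟨hint, hle.trans ((RottingBandit.regret_bound_le hc₁ hc₁' hlo hhi hT hV hδ1 hδT).trans ?_)⟩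
    calc _ ≤ RottingBandit.regretConst β c₁ lo hi * (1 + Real.log T) ^ 2 *
          ((2 + 3 * c₁ ^ (-(max β 1 + 1))) * R) := mul_le_mul_of_nonneg_left hR (by positivity)
      _ = _ := by ring
  -- Comparing the scales selects the threshold and the rate at once. When `scaleS` is the smaller,
  -- `V ≤ T * scaleV` is what keeps `R_S` below `R_V`.
  rcases le_total (RottingBandit.scaleV β V T) (RottingBandit.scaleS β S T) with h | h
  · rw [min_eq_left (mul_le_mul_of_nonneg_left h hc₁.le),
      min_eq_left ((mul_le_mul_of_nonneg_left h hT0.le).trans (le_max_left _ _))]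
    refine main _ (RottingBandit.one_div_le_scaleV hT) (RottingBandit.scaleV_le_one hT hV hVT) _
      (Or.inl ?_) _ (RottingBandit.tuning_slow hc₁ hc₁' hT hV hVT)
    push_cast
    exact Nat.lt_floor_add_one _
  · rw [min_eq_right (mul_le_mul_of_nonneg_left h hc₁.le),
      min_eq_right (max_le (mul_le_mul_of_nonneg_left h hT0.le) hVscale)]
    exact main _ (RottingBandit.one_div_le_scaleS hT hS) (RottingBandit.scaleS_le_one hT hST) S
      (Or.inr le_rfl) _ (RottingBandit.tuning_abrupt hc₁ hc₁' hT hS)
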